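/- On the real RAM with unit cost per operation (exact real arithmetic $+,-,\cdot,/$ and comparisons; integer arithmetic and random access to arrays on words of $O(\log n)$ bits), there is an algorithm that, given $n\ge 1$, a set $L$ of $n$ lines in the plane (by coefficients $a,b,c$ of equations $ax+by=c$ with $(a,b)\neq(0,0)$) and a set $P$ of $n$ points in the plane (by their coordinates), computes an exact minimum spanning tree of $P$ in $O(n^2\log n)$ time in the worst case. Here the spanning trees of $P$ are the spanning trees of the complete graph on $P$, the weight of an edge $pq$ is the crossing distance $D_L(p,q)$, that is, the number of lines of $L$ that intersect the segment $pq$, and the weight of a tree is the sum of the weights of its edges. -/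

import Mathlib

open Filter Asymptotics

/-! A real random access machine with unit cost, given by a structured programming language,
and the minimum spanning tree problem for the crossing metric of lines in the plane. -/

namespace RealRAM

/-- The memory of the machine.  There are integer (natural number) cells and real cells; of each
kind there are named registers and named one-dimensional arrays.  A program is a finite text, so it
uses only finitely many names; only the position inside an array can be computed at run time. -/
structure State where
  nreg : ℕ → ℕ
  narr : ℕ → ℕ → ℕ
  rreg : ℕ → ℝ
  rarr : ℕ → ℕ → ℝ

/-- Integer expressions; `sub` is truncated subtraction and `div` is division with remainder. -/
inductive NExpr where
  | const (c : ℕ)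
  | reg (x : ℕ)
  | get (A : ℕ) (i : NExpr)
  | add (e f : NExpr)
  | sub (e f : NExpr)
  | mul (e f : NExpr)
  | div (e f : NExpr)

/-- Real expressions.  The only constants are the integers, and there is no rounding, no root and
no other conversion between reals and integers. -/
inductive RExpr where
  | const (c : ℤ)
  | reg (x : ℕ)
  | get (A : ℕ) (i : NExpr)
  | add (e f : RExpr)
  | sub (e f : RExpr)
  | mul (e f : RExpr)
  | div (e f : RExpr)

/-- Tests: comparisons of integers and of reals, and their Boolean combinations. -/
inductive Test where
  | nlt (e f : NExpr)
  | rlt (e f : RExpr)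
  | not (b : Test)
  | and (b c : Test)

/-- Programs. -/
inductive Prog where
  | skip
  | setNReg (x : ℕ) (e : NExpr)
  | setNArr (A : ℕ) (i e : NExpr)
  | setRReg (x : ℕ) (e : RExpr)
  | setRArr (A : ℕ) (i : NExpr) (e : RExpr)
  | seq (p q : Prog)
  | ite (b : Test) (p q : Prog)
  | while (b : Test) (p : Prog)

/-- The value of an integer expression. -/
def NExpr.eval (s : State) : NExpr → ℕ
  | const c => c
  | reg x => s.nreg x
  | get A i => s.narr A (i.eval s)
  | add e f => e.eval s + f.eval s
  | sub e f => e.eval s - f.eval s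
  | mul e f => e.eval s * f.eval s
  | div e f => e.eval s / f.eval s

/-- The evaluation of an integer expression succeeds on a machine whose words hold the numbers
`0, …, W`: no intermediate result exceeds `W`, and there is no division by zero. -/
def NExpr.Ok (W : ℕ) (s : State) : NExpr → Prop
  | const c => c ≤ W
  | reg _ => True
  | get _ i => i.Ok W s
  | add e f => e.Ok W s ∧ f.Ok W s ∧ e.eval s + f.eval s ≤ W
  | sub e f => e.Ok W s ∧ f.Ok W s
  | mul e f => e.Ok W s ∧ f.Ok W s ∧ e.eval s * f.eval s ≤ W
  | div e f => e.Ok W s ∧ f.Ok W s ∧ f.eval s ≠ 0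

/-- The number of elementary operations in an integer expression. -/
def NExpr.cost : NExpr → ℕ
  | const _ => 1
  | reg _ => 1
  | get _ i => i.cost + 1
  | add e f => e.cost + f.cost + 1
  | sub e f => e.cost + f.cost + 1
  | mul e f => e.cost + f.cost + 1
  | div e f => e.cost + f.cost + 1

/-- The value of a real expression (exact arithmetic). -/
noncomputable def RExpr.eval (s : State) : RExpr → ℝ
  | const c => (c : ℝ)
  | reg x => s.rreg x
  | get A i => s.rarr A (i.eval s)
  | add e f => e.eval s + f.eval s
  | sub e f => e.eval s - f.eval s
  | mul e f => e.eval s * f.eval s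
  | div e f => e.eval s / f.eval s

/-- The evaluation of a real expression succeeds: array positions are computed without overflow,
and there is no division by zero. -/
def RExpr.Ok (W : ℕ) (s : State) : RExpr → Prop
  | const _ => True
  | reg _ => True
  | get _ i => i.Ok W s
  | add e f => e.Ok W s ∧ f.Ok W s
  | sub e f => e.Ok W s ∧ f.Ok W s
  | mul e f => e.Ok W s ∧ f.Ok W s
  | div e f => e.Ok W s ∧ f.Ok W s ∧ f.eval s ≠ 0

/-- The number of elementary operations in a real expression. -/
def RExpr.cost : RExpr → ℕ
  | const _ => 1
  | reg _ => 1
  | get _ i => i.cost + 1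
  | add e f => e.cost + f.cost + 1
  | sub e f => e.cost + f.cost + 1
  | mul e f => e.cost + f.cost + 1
  | div e f => e.cost + f.cost + 1

/-- The test holds in the state `s`. -/
def Test.Holds (s : State) : Test → Prop
  | nlt e f => e.eval s < f.eval s
  | rlt e f => e.eval s < f.eval s
  | not b => ¬ b.Holds s
  | and b c => b.Holds s ∧ c.Holds s

/-- The evaluation of the test succeeds. -/
def Test.Ok (W : ℕ) (s : State) : Test → Prop
  | nlt e f => e.Ok W s ∧ f.Ok W s
  | rlt e f => e.Ok W s ∧ f.Ok W s
  | not b => b.Ok W s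
  | and b c => b.Ok W s ∧ c.Ok W s

/-- The number of elementary operations in a test. -/
def Test.cost : Test → ℕ
  | nlt e f => e.cost + f.cost + 1
  | rlt e f => e.cost + f.cost + 1
  | not b => b.cost + 1
  | and b c => b.cost + c.cost + 1

/-- Write `v` into the integer register `x`. -/
def State.updNReg (s : State) (x v : ℕ) : State :=
  { s with nreg := Function.update s.nreg x v }

/-- Write `v` into position `i` of the integer array `A`. -/
def State.updNArr (s : State) (A i v : ℕ) : State :=
  { s with narr := Function.update s.narr A (Function.update (s.narr A) i v) }

/-- Write `v` into the real register `x`. -/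
noncomputable def State.updRReg (s : State) (x : ℕ) (v : ℝ) : State :=
  { s with rreg := Function.update s.rreg x v }

/-- Write `v` into position `i` of the real array `A`. -/
noncomputable def State.updRArr (s : State) (A i : ℕ) (v : ℝ) : State :=
  { s with rarr := Function.update s.rarr A (Function.update (s.rarr A) i v) }

/-- `Exec W p s t s'`: on a machine whose words hold the numbers `0, …, W`, the program `p`, started
in the state `s`, halts without an error after `t` elementary operations in the state `s'`.  A program
that overflows, divides by zero or runs forever has no such `t` and `s'`. -/
inductive Exec (W : ℕ) : Prog → State → ℕ → State → Prop
  | skip (s : State) : Exec W .skip s 1 s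
  | setNReg {s : State} {x : ℕ} {e : NExpr} (he : e.Ok W s) :
      Exec W (.setNReg x e) s (e.cost + 1) (s.updNReg x (e.eval s))
  | setNArr {s : State} {A : ℕ} {i e : NExpr} (hi : i.Ok W s) (he : e.Ok W s) :
      Exec W (.setNArr A i e) s (i.cost + e.cost + 1) (s.updNArr A (i.eval s) (e.eval s))
  | setRReg {s : State} {x : ℕ} {e : RExpr} (he : e.Ok W s) :
      Exec W (.setRReg x e) s (e.cost + 1) (s.updRReg x (e.eval s))
  | setRArr {s : State} {A : ℕ} {i : NExpr} {e : RExpr} (hi : i.Ok W s) (he : e.Ok W s) :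
      Exec W (.setRArr A i e) s (i.cost + e.cost + 1) (s.updRArr A (i.eval s) (e.eval s))
  | seq {p q : Prog} {s s' s'' : State} {t t' : ℕ} (hp : Exec W p s t s')
      (hq : Exec W q s' t' s'') : Exec W (.seq p q) s (t + t') s''
  | iteTrue {b : Test} {p q : Prog} {s s' : State} {t : ℕ} (hok : b.Ok W s) (hb : b.Holds s)
      (hp : Exec W p s t s') : Exec W (.ite b p q) s (b.cost + t) s'
  | iteFalse {b : Test} {p q : Prog} {s s' : State} {t : ℕ} (hok : b.Ok W s) (hb : ¬ b.Holds s)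
      (hq : Exec W q s t s') : Exec W (.ite b p q) s (b.cost + t) s'
  | whileFalse {b : Test} {p : Prog} {s : State} (hok : b.Ok W s) (hb : ¬ b.Holds s) :
      Exec W (.while b p) s b.cost s
  | whileTrue {b : Test} {p : Prog} {s s' s'' : State} {t t' : ℕ} (hok : b.Ok W s)
      (hb : b.Holds s) (hp : Exec W p s t s') (hw : Exec W (.while b p) s' t' s'') :
      Exec W (.while b p) s (b.cost + t + t') s''

end RealRAM

namespace CrossingMST

/-- The Euclidean plane. -/
abbrev Plane : Type := EuclideanSpace ℝ (Fin 2)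

/-- The crossing distance of `p` and `q`: the number of members of `L` that intersect the (closed)
segment with endpoints `p` and `q`. -/
noncomputable def crossingDist (L : Set (Set Plane)) (p q : Plane) : ℕ :=
  {l | l ∈ L ∧ (l ∩ segment ℝ p q).Nonempty}.ncard

theorem crossingDist_comm (L : Set (Set Plane)) (p q : Plane) :
    crossingDist L p q = crossingDist L q p := by
  unfold crossingDist
  rw [segment_symm]

/-- The weight of a tree (or any graph) whose vertices are indices of the points `pt i`: the sum of
the crossing distances over its edges. -/
noncomputable def weight {n : ℕ} (L : Set (Set Plane)) (pt : Fin n → Plane)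
    (G : SimpleGraph (Fin n)) : ℕ :=
  ∑ᶠ e ∈ G.edgeSet,
    Sym2.lift ⟨fun i j => crossingDist L (pt i) (pt j), fun _ _ => crossingDist_comm L _ _⟩ e

/-- `G` is a minimum spanning tree of the points `pt i` under the crossing metric of `L`. -/
def IsMST {n : ℕ} (L : Set (Set Plane)) (pt : Fin n → Plane) (G : SimpleGraph (Fin n)) : Prop :=
  G.IsTree ∧ ∀ H : SimpleGraph (Fin n), H.IsTree → weight L pt G ≤ weight L pt H

/-- The set of points with `a x + b y = c`; a line if `(a, b) ≠ (0, 0)`. -/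
def lineOf (a b c : ℝ) : Set Plane := {q | a * q 0 + b * q 1 = c}

/-- An input of size `n`: coefficients of `n` different lines, and `n` different points. -/
structure Input (n : ℕ) where
  a : Fin n → ℝ
  b : Fin n → ℝ
  c : Fin n → ℝ
  pt : Fin n → Plane
  nondegenerate : ∀ i, a i ≠ 0 ∨ b i ≠ 0
  lines_distinct : Function.Injective fun i => lineOf (a i) (b i) (c i)
  points_distinct : Function.Injective pt

/-- The set of lines of the input. -/
def Input.lines {n : ℕ} (I : Input n) : Set (Set Plane) :=
  Set.range fun i => lineOf (I.a i) (I.b i) (I.c i)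

/-- An array with the given first `n` entries and zeros behind them. -/
noncomputable def padded {n : ℕ} (v : Fin n → ℝ) (i : ℕ) : ℝ :=
  if h : i < n then v ⟨i, h⟩ else 0

/-- The memory before the run: integer register `0` holds `n`, the real arrays `0`, `1`, `2` hold the
coefficients of the lines, the real arrays `3`, `4` the coordinates of the points, and all the other
cells hold `0`. -/
noncomputable def Input.initial {n : ℕ} (I : Input n) : RealRAM.State where
  nreg x := if x = 0 then n else 0
  narr _ _ := 0
  rreg _ := 0
  rarr
    | 0 => padded I.a
    | 1 => padded I.b
    | 2 => padded I.c
    | 3 => padded fun i => I.pt i 0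
    | 4 => padded fun i => I.pt i 1
    | _ => fun _ => 0

/-- The graph that is read off the memory after the run: its edges are the pairs of indices in
positions `0, …, n - 2` of the integer arrays `0` and `1`. -/
def outputGraph (n : ℕ) (s : RealRAM.State) : SimpleGraph (Fin n) :=
  SimpleGraph.fromEdgeSet
    {e | ∃ m : ℕ, m + 1 < n ∧ ∃ i j : Fin n,
      s.narr 0 m = i ∧ s.narr 1 m = j ∧ e = s(i, j)}

/-- `p` computes a minimum spanning tree of `n` points under the crossing metric of `n` lines, for
each `n ≥ 1` and each such input, in at most `T n` elementary operations on words with values at most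
`(n + 1) ^ k` (that is, words of `O(log n)` bits). -/
def ComputesMST (p : RealRAM.Prog) (k : ℕ) (T : ℕ → ℕ) : Prop :=
  ∀ n : ℕ, 1 ≤ n → ∀ I : Input n, ∃ (t : ℕ) (s : RealRAM.State),
    RealRAM.Exec ((n + 1) ^ k) p I.initial t s ∧ t ≤ T n ∧
      IsMST I.lines I.pt (outputGraph n s)

end CrossingMST

/-! ### Program logic: time-bounded Hoare rules for the machine -/

namespace RealRAM

/-! A closed segment misses a line exactly when its endpoints lie strictly on the same side. So the
crossing distance of two points is `n` minus the number `agree` of lines that have both strictly on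
one side (`Frame.Describes.crossingDist_add_agree`), and a minimum spanning tree is one that
maximises `agree`. Prim's algorithm asks for O(n²) such numbers; it suffices to answer each in O(log
n) time after O(n²) preprocessing.

Orient the equations so that all normals have angle in [0, π), and sort the lines by that angle. If
the direction from `u` to `v` has angle in [-π/2, π/2), the lines whose signed value grows from `u`
to `v` are those with normal angle below a threshold, hence an initial segment of the order
(`Frame.Rising.of_le`), whose length `k` is found by binary search. Where the value grows, both
values are negative iff that of `v` is, and both are positive iff that of `u` is; on the other lines
`u` and `v` change roles. So `agree` is a combination of a few prefix counts, tabulated once for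
each point (`Frame.agree_eq`).

Prim's algorithm is correct by the cut property (`Prim.insert`), which rests on an edge exchange in
trees. The machine side reduces loop-free code to weakest preconditions (`Runs.of_wp`) and loops to
invariants (`Runs.forTo`, `Runs.while_halving`). -/

@[simp] theorem State.updNReg_nreg (s : State) (x v y : ℕ) :
    (s.updNReg x v).nreg y = if y = x then v else s.nreg y := by
  simp [State.updNReg, Function.update_apply]
@[simp] theorem State.updNReg_narr (s : State) (x v : ℕ) : (s.updNReg x v).narr = s.narr := rfl
@[simp] theorem State.updNReg_rarr (s : State) (x v : ℕ) : (s.updNReg x v).rarr = s.rarr := rfl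

@[simp] theorem State.updNArr_nreg (s : State) (A i v : ℕ) :
    (s.updNArr A i v).nreg = s.nreg := rfl
@[simp] theorem State.updNArr_narr (s : State) (A i v B j : ℕ) :
    (s.updNArr A i v).narr B j = if B = A ∧ j = i then v else s.narr B j := by
  by_cases h : B = A
  · subst h; simp [State.updNArr, Function.update_apply]
  · simp [State.updNArr, h]
@[simp] theorem State.updNArr_rarr (s : State) (A i v : ℕ) :
    (s.updNArr A i v).rarr = s.rarr := rfl

@[simp] theorem State.updRArr_nreg (s : State) (A i : ℕ) (v : ℝ) :
    (s.updRArr A i v).nreg = s.nreg := rfl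
@[simp] theorem State.updRArr_narr (s : State) (A i : ℕ) (v : ℝ) :
    (s.updRArr A i v).narr = s.narr := rfl
@[simp] theorem State.updRArr_rarr (s : State) (A i : ℕ) (v : ℝ) (B j : ℕ) :
    (s.updRArr A i v).rarr B j = if B = A ∧ j = i then v else s.rarr B j := by
  by_cases h : B = A
  · subst h; simp [State.updRArr, Function.update_apply]
  · simp [State.updRArr, h]

/-- The program `p`, started in `s`, halts after at most `t` operations in a state with `Q`. -/
def Runs (W : ℕ) (p : Prog) (s : State) (t : ℕ) (Q : State → Prop) : Prop :=
  ∃ t' s', Exec W p s t' s' ∧ t' ≤ t ∧ Q s'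

variable {W : ℕ} {p q : Prog} {s : State} {t t' : ℕ} {Q R : State → Prop}

theorem Runs.mono (h : Runs W p s t R) (ht : t ≤ t') (hQ : ∀ s', R s' → Q s') :
    Runs W p s t' Q := by
  obtain ⟨t₀, s', he, ht₀, hR⟩ := h
  exact ⟨t₀, s', he, ht₀.trans ht, hQ s' hR⟩

theorem Runs.seq {t₁ t₂ : ℕ} (hp : Runs W p s t₁ R) (hq : ∀ s', R s' → Runs W q s' t₂ Q)
    (ht : t₁ + t₂ ≤ t) : Runs W (.seq p q) s t Q := by
  obtain ⟨a, s₁, h₁, ha, hR⟩ := hp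
  obtain ⟨b, s₂, h₂, hb, hQ⟩ := hq s₁ hR
  exact ⟨a + b, s₂, .seq h₁ h₂, by omega, hQ⟩

theorem Runs.ite {b : Test} {c : ℕ} (hok : b.Ok W s) (hp : b.Holds s → Runs W p s c Q)
    (hq : ¬ b.Holds s → Runs W q s c Q) (ht : b.cost + c ≤ t) : Runs W (.ite b p q) s t Q := by
  by_cases hb : b.Holds s
  · obtain ⟨a, s₁, h₁, ha, hR⟩ := hp hb
    exact ⟨_, s₁, .iteTrue hok hb h₁, by omega, hR⟩
  · obtain ⟨a, s₁, h₁, ha, hR⟩ := hq hb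
    exact ⟨_, s₁, .iteFalse hok hb h₁, by omega, hR⟩

/-- The weakest precondition of a program without loops. -/
def wp (W : ℕ) : Prog → (State → Prop) → State → Prop
  | .skip, Q => Q
  | .setNReg x e, Q => fun s => e.Ok W s ∧ Q (s.updNReg x (e.eval s))
  | .setNArr A i e, Q => fun s => i.Ok W s ∧ e.Ok W s ∧ Q (s.updNArr A (i.eval s) (e.eval s))
  | .setRReg x e, Q => fun s => e.Ok W s ∧ Q (s.updRReg x (e.eval s))
  | .setRArr A i e, Q => fun s => i.Ok W s ∧ e.Ok W s ∧ Q (s.updRArr A (i.eval s) (e.eval s))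
  | .seq p q, Q => wp W p (wp W q Q)
  | .ite b p q, Q => fun s => b.Ok W s ∧ (b.Holds s → wp W p Q s) ∧ (¬ b.Holds s → wp W q Q s)
  -- Loops are excluded here, which makes the junk value `0` of `maxCost` on loops harmless.
  | .while _ _, _ => fun _ => False

/-- The largest number of operations in a run of a program without loops. -/
def maxCost : Prog → ℕ
  | .skip => 1
  | .setNReg _ e => e.cost + 1
  | .setNArr _ i e => i.cost + e.cost + 1
  | .setRReg _ e => e.cost + 1
  | .setRArr _ i e => i.cost + e.cost + 1
  | .seq p q => maxCost p + maxCost q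
  -- The sum of the branches instead of their maximum: cruder, but still an upper bound.
  | .ite b p q => b.cost + (maxCost p + maxCost q)
  | .while _ _ => 0

/-- For a concrete program the time bound is an inequality between numerals, mostly settled by
`decide`, and `wp` unfolds by `simp`. -/
theorem Runs.of_wp (h : wp W p Q s) (ht : maxCost p ≤ t) : Runs W p s t Q := by
  suffices H : ∀ (p : Prog) (Q : State → Prop) (s : State),
      wp W p Q s → Runs W p s (maxCost p) Q from (H p Q s h).mono ht fun _ h => h
  clear * -
  intro p
  induction p with
  | skip => exact fun Q s h => ⟨_, _, .skip s, le_rfl, h⟩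
  | setNReg x e => exact fun Q s h => ⟨_, _, .setNReg h.1, le_rfl, h.2⟩
  | setNArr A i e => exact fun Q s h => ⟨_, _, .setNArr h.1 h.2.1, le_rfl, h.2.2⟩
  | setRReg x e => exact fun Q s h => ⟨_, _, .setRReg h.1, le_rfl, h.2⟩
  | setRArr A i e => exact fun Q s h => ⟨_, _, .setRArr h.1 h.2.1, le_rfl, h.2.2⟩
  | seq p q hp hq => exact fun Q s h => (hp _ s h).seq (fun s' hs' => hq Q s' hs') le_rfl
  | ite b p q hp hq =>
    exact fun Q s h => Runs.ite h.1 (fun hb => (hp Q s (h.2.1 hb)).mono (by omega) fun _ h => h)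
      (fun hb => (hq Q s (h.2.2 hb)).mono (Nat.le_add_left _ _) fun _ h => h) le_rfl
  | _ => exact fun Q s h => h.elim

/-- A loop that halts since a natural number quantity `μ` at least halves in each round. -/
theorem Runs.while_halving {b : Test} {c : ℕ} (Inv : State → Prop) (μ : State → ℕ)
    (hok : ∀ s, Inv s → b.Ok W s) (hpos : ∀ s, Inv s → b.Holds s → 0 < μ s)
    (step : ∀ s, Inv s → b.Holds s →
      Runs W p s c fun s' => Inv s' ∧ μ s' ≤ μ s / 2)
    (hQ : ∀ s, Inv s → ¬ b.Holds s → Q s) (s : State) (hs : Inv s) {N : ℕ} (hN : μ s ≤ N) :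
    Runs W (.while b p) s ((Nat.log 2 N + 2) * (b.cost + c)) Q := by
  -- At most `k` rounds if `μ s < 2 ^ k`, and then one failing test.
  suffices H : ∀ k s, Inv s → μ s < 2 ^ k →
      Runs W (.while b p) s (k * (b.cost + c) + b.cost) Q by
    refine (H (Nat.log 2 N + 1) s hs (hN.trans_lt (Nat.lt_pow_succ_log_self one_lt_two N))).mono
      ?_ fun _ h => h
    rw [show Nat.log 2 N + 2 = Nat.log 2 N + 1 + 1 from rfl, Nat.succ_mul (Nat.log 2 N + 1)]
    omega
  clear hs hN s
  intro k
  induction k with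
  | zero =>
    intro s hs hμ
    have hb : ¬ b.Holds s := fun hb => by have := hpos s hs hb; omega
    exact ⟨_, s, .whileFalse (hok s hs) hb, by omega, hQ s hs hb⟩
  | succ k ih =>
    intro s hs hμ
    by_cases hb : b.Holds s
    · obtain ⟨t₁, s₁, h₁, ht₁, hi, hh⟩ := step s hs hb
      obtain ⟨t₂, s₂, h₂, ht₂, hq⟩ := ih s₁ hi (by rw [pow_succ] at hμ; omega)
      refine ⟨_, s₂, .whileTrue (hok s hs) hb h₁ h₂, ?_, hq⟩
      rw [Nat.succ_mul]; omega
    · exact ⟨_, s, .whileFalse (hok s hs) hb, by omega, hQ s hs hb⟩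

/-- `for i := 0, …, e - 1 do p`. -/
def Prog.forTo (i : ℕ) (e : NExpr) (p : Prog) : Prog :=
  .seq (.setNReg i (.const 0))
    (.while (.nlt (.reg i) e) (.seq p (.setNReg i (.add (.reg i) (.const 1)))))

/-- `Inv m` speaks of the state in which the counter already holds `m`, so the step establishes `Inv
(m + 1)` after the increment. Each round evaluates the bound `e` afresh, hence `guard`. The constant
`6` is 2 for the comparison and 4 for the increment. -/
theorem Runs.forTo {i : ℕ} {e : NExpr} {N c : ℕ} (Inv : ℕ → State → Prop) (hNW : N ≤ W)
    (init : Inv 0 (s.updNReg i 0))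
    (guard : ∀ m s, m ≤ N → Inv m s → s.nreg i = m ∧ e.Ok W s ∧ e.eval s = N)
    (step : ∀ m s, m < N → Inv m s → s.nreg i = m →
      Runs W p s c fun s' => s'.nreg i = m ∧ Inv (m + 1) (s'.updNReg i (m + 1)))
    (hQ : ∀ s, Inv N s → Q s) (ht : (N + 1) * (c + e.cost + 6) ≤ t) :
    Runs W (.forTo i e p) s t Q := by
  have H : ∀ k m s, m + k = N → Inv m s →
      Runs W (.while (.nlt (.reg i) e) (.seq p (.setNReg i (.add (.reg i) (.const 1))))) s
        (k * (c + e.cost + 6) + e.cost + 2) Q := by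
    intro k
    induction k with
    | zero =>
      intro m s hm hs
      obtain rfl : m = N := hm
      obtain ⟨hi, he, hv⟩ := guard m s le_rfl hs
      exact ⟨_, s, .whileFalse ⟨trivial, he⟩ (by simp [Test.Holds, NExpr.eval, hi, hv]),
        by simp [Test.cost, NExpr.cost]; omega, hQ s hs⟩
    | succ k ih =>
      intro m s hm hs
      obtain ⟨hi, he, hv⟩ := guard m s (by omega) hs
      obtain ⟨t₁, s₁, h₁, ht₁, hi₁, hs₁⟩ := step m s (by omega) hs hi
      obtain ⟨t₂, s₂, h₂, ht₂, hq⟩ := ih (m + 1) _ (by omega) hs₁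
      refine ⟨_, s₂, .whileTrue (t' := t₂) ⟨trivial, he⟩
        (by simp only [Test.Holds, NExpr.eval, hi, hv]; omega) (.seq h₁ (.setNReg ?_)) ?_, ?_, hq⟩
      · simp only [NExpr.Ok, NExpr.eval, hi₁, true_and]; omega
      · simpa only [NExpr.eval, hi₁] using h₂
      · simp only [Test.cost, NExpr.cost, Nat.succ_mul]; omega
  have hr := H N 0 (s.updNReg i 0) (by omega) init
  obtain ⟨t₁, s₁, h₁, ht₁, hq⟩ := hr
  refine ⟨_, s₁, .seq (.setNReg (e := .const 0) (Nat.zero_le _)) h₁, ?_, hq⟩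
  simp only [NExpr.cost]
  rw [Nat.succ_mul] at ht
  omega

end RealRAM

/-! ### Spanning trees: edge exchange and the cut property -/

namespace SimpleGraph

/-- Exchange property of spanning trees: an edge across a cut `S` that is missing in a tree can
replace some edge of the tree across the same cut. -/
theorem IsTree.exists_exchange {V : Type*} [Finite V] {H : SimpleGraph V} (hH : H.IsTree)
    {S : Set V} {u v : V} (hu : u ∈ S) (hv : v ∉ S) (huv : ¬ H.Adj u v) :
    ∃ x y : V, x ∈ S ∧ y ∉ S ∧ H.Adj x y ∧ ∃ H' : SimpleGraph V, H'.IsTree ∧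
      H'.edgeSet = insert s(u, v) (H.edgeSet \ {s(x, y)}) := by
  classical
  have hne : u ≠ v := fun h => hv (h ▸ hu)
  obtain ⟨p, hp⟩ := hH.connected.exists_isPath v u
  -- The path of the tree from `u` to `v` must leave `S`; the edge where it does is the one to
  -- remove.
  obtain ⟨d, hd, hd1, hd2⟩ := p.reverse.exists_boundary_dart S hu hv
  obtain ⟨⟨x, y⟩, hxy⟩ := d
  simp only at hd1 hd2
  have hmem : s(x, y) ∈ p.edges := by
    have : s(x, y) ∈ p.reverse.edges := List.mem_map.2 ⟨_, hd, rfl⟩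
    simpa using this
  set G := H ⊔ edge u v with hG
  have hHG : H ≤ G := le_sup_left
  have hadj : G.Adj u v := Or.inr (by simp [edge_adj, hne])
  have hGc : G.Connected := hH.connected.mono hHG
  have hcyc : (Walk.cons hadj (p.mapLe hHG)).IsCycle := by
    rw [Walk.cons_isCycle_iff]
    refine ⟨(Walk.isPath_mapLe hHG).2 hp, fun h => huv ?_⟩
    rw [Walk.edges_mapLe_eq_edges] at h
    exact p.adj_of_mem_edges h
  -- The removed edge lies on the cycle closed by the new edge, so connectedness survives; the edge
  -- count then gives a tree.
  have hnb : ¬ G.IsBridge s(x, y) := fun h => by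
    refine h.notMem_edges_of_isCycle hcyc ?_
    rw [Walk.edges_cons, Walk.edges_mapLe_eq_edges]
    exact List.mem_cons_of_mem _ hmem
  have hc := hGc.connected_delete_edge_of_not_isBridge hnb
  have hexy : s(x, y) ≠ s(u, v) := fun h => huv ((mem_edgeSet H).1 (h ▸ (mem_edgeSet H).2 hxy))
  have hE : (G.deleteEdges {s(x, y)}).edgeSet =
      insert s(u, v) (H.edgeSet \ {s(x, y)}) := by
    rw [edgeSet_deleteEdges, hG, edgeSet_sup, edgeSet_edge_of_ne hne, Set.union_singleton,
      Set.insert_sdiff_of_notMem _ (by simpa using hexy.symm)]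
  refine ⟨x, y, hd1, hd2, hxy, _, isTree_iff_connected_and_card.2 ⟨hc, ?_⟩, hE⟩
  have h0 := (isTree_iff_connected_and_card.1 hH).2
  rw [hE, ← h0, Nat.card_coe_set_eq, Nat.card_coe_set_eq, Set.ncard_insert_of_notMem (by simp [huv]),
    Set.ncard_sdiff_singleton_add_one (by simpa using hxy)]

end SimpleGraph

namespace CrossingMST
open SimpleGraph

/-- The state of Prim's algorithm: `S` is the set of vertices reached, `E` the set of edges chosen. -/
structure Prim {n : ℕ} (f : Sym2 (Fin n) → ℕ) (S : Finset (Fin n)) (E : Finset (Sym2 (Fin n))) :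
    Prop where
  card : E.card + 1 = S.card
  mem : ∀ e ∈ E, ∀ x ∈ e, x ∈ S
  -- Stated against every competitor `H`, so that no minimum tree has to be chosen.
  extend : ∀ H : SimpleGraph (Fin n), H.IsTree → ∃ H' : SimpleGraph (Fin n), H'.IsTree ∧
    (∀ e ∈ E, e ∈ H'.edgeSet) ∧ ∑ᶠ e ∈ H'.edgeSet, f e ≤ ∑ᶠ e ∈ H.edgeSet, f e

variable {n : ℕ} {f : Sym2 (Fin n) → ℕ} {S : Finset (Fin n)} {E : Finset (Sym2 (Fin n))}

theorem Prim.singleton (x : Fin n) : Prim f {x} ∅ where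
  card := by simp
  mem := by simp
  extend := fun H hH => ⟨H, hH, by simp, le_rfl⟩

/-- The cut property. If the tree that contains `E` lacks the new edge, exchange it for an edge
across the cut, which is no lighter by `hmin`. The edge given up is not in `E`, since edges of `E`
stay inside `S`. -/
theorem Prim.insert (h : Prim f S E) {u v : Fin n} (hu : u ∈ S) (hv : v ∉ S)
    (hmin : ∀ x ∈ S, ∀ y ∉ S, f s(u, v) ≤ f s(x, y)) :
    Prim f (insert v S) (insert s(u, v) E) where
  card := by
    have : s(u, v) ∉ E := fun he => hv (h.mem _ he v (by simp))
    rw [Finset.card_insert_of_notMem this, Finset.card_insert_of_notMem hv, h.card]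
  mem := by
    intro e he x hx
    rcases Finset.mem_insert.1 he with rfl | he
    · rcases Sym2.mem_iff.1 hx with rfl | rfl <;> simp [hu]
    · exact Finset.mem_insert_of_mem (h.mem e he x hx)
  extend := by
    intro H hH
    obtain ⟨H', hH', hE, hle⟩ := h.extend H hH
    by_cases huv : H'.Adj u v
    · refine ⟨H', hH', ?_, hle⟩
      intro e he
      rcases Finset.mem_insert.1 he with rfl | he
      · exact huv
      · exact hE e he
    obtain ⟨x, y, hx, hy, hxy, H₂, hH₂, hE₂⟩ := hH'.exists_exchange (S := (S : Set (Fin n)))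
      (by simpa using hu) (by simpa using hv) huv
    refine ⟨H₂, hH₂, ?_, le_trans ?_ hle⟩
    · intro e he
      rw [hE₂]
      rcases Finset.mem_insert.1 he with rfl | he
      · exact Set.mem_insert _ _
      · refine Set.mem_insert_of_mem _ ⟨hE e he, ?_⟩
        rintro rfl
        exact hy (by simpa using h.mem _ he y (by simp))
    · rw [hE₂, finsum_mem_insert _ (by simp [huv]) (Set.toFinite _)]
      have h1 : s(x, y) ∉ H'.edgeSet \ {s(x, y)} := by simp
      have h2 : H'.edgeSet = Insert.insert s(x, y) (H'.edgeSet \ {s(x, y)}) := by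
        rw [Set.insert_sdiff_singleton, Set.insert_eq_of_mem (by simpa using hxy)]
      conv_rhs => rw [h2, finsum_mem_insert _ h1 (Set.toFinite _)]
      exact Nat.add_le_add_right (hmin x (by simpa using hx) y (by simpa using hy)) _

/-- Now `E` has `n - 1` edges, as many as any spanning tree, so a tree that contains `E` equals it.
-/
theorem Prim.fromEdgeSet_minimal [NeZero n] (h : Prim f Finset.univ E) :
    (fromEdgeSet (E : Set (Sym2 (Fin n)))).IsTree ∧ ∀ H : SimpleGraph (Fin n), H.IsTree →
      ∑ᶠ e ∈ (fromEdgeSet (E : Set (Sym2 (Fin n)))).edgeSet, f e ≤ ∑ᶠ e ∈ H.edgeSet, f e := by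
  have key : ∀ H' : SimpleGraph (Fin n), H'.IsTree → (∀ e ∈ E, e ∈ H'.edgeSet) →
      fromEdgeSet (E : Set (Sym2 (Fin n))) = H' := by
    intro H' hH' hE
    have hc := (isTree_iff_connected_and_card.1 hH').2
    have : (E : Set (Sym2 (Fin n))) = H'.edgeSet := by
      refine Set.eq_of_subset_of_ncard_le (fun e he => hE e he) ?_ (Set.toFinite _)
      have := h.card
      rw [Nat.card_coe_set_eq] at hc
      rw [Set.ncard_coe_finset]
      simp at hc this
      omega
    rw [this, fromEdgeSet_edgeSet]
  -- `extend` needs some tree to start from; any spanning tree of the complete graph serves.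
  obtain ⟨T, -, hT⟩ := (connected_top (V := Fin n)).exists_isTree_le
  obtain ⟨H', hH', hE, -⟩ := h.extend T hT
  refine ⟨key H' hH' hE ▸ hH', fun H hH => ?_⟩
  obtain ⟨H', hH', hE, hle⟩ := h.extend H hH
  rwa [key H' hH' hE]

end CrossingMST

/-! ### Geometry: sorting by angle and counting sides by prefixes -/

namespace CrossingMST

/-- Coefficients of lines `A i x + B i y = C i` and coordinates of points `(X i, Y i)`. -/
structure Frame where
  A : ℕ → ℝ
  B : ℕ → ℝ
  C : ℕ → ℝ
  X : ℕ → ℝ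
  Y : ℕ → ℝ

namespace Frame

variable (F : Frame) (n : ℕ) (o : ℕ → ℕ)

/-- Negative, zero or positive according to the side of the line `l` on which the point `p` is. -/
def side (l p : ℕ) : ℝ := F.A l * F.X p + F.B l * F.Y p - F.C l

/-- All normal vectors of the first `n` lines are in the half-open upper half-plane. -/
def Upright : Prop := ∀ i < n, 0 < F.B i ∨ F.B i = 0 ∧ 0 < F.A i

/-- The order of lines by the angle of their normal vectors; ties are broken by index. -/
def Before (i j : ℕ) : Prop :=
  F.B i * F.A j < F.A i * F.B j ∨ F.B i * F.A j = F.A i * F.B j ∧ i < j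

open Classical in
/-- The position of the line `i` in the sorted order. -/
noncomputable def rank (i : ℕ) : ℕ := ((Finset.range n).filter fun j => F.Before j i).card

/-- `o` lists the first `n` lines by increasing angle. -/
structure Sorted : Prop where
  bij : Set.BijOn o (Finset.range n) (Finset.range n)
  mono : ∀ j k, j ≤ k → k < n → F.B (o j) * F.A (o k) ≤ F.A (o j) * F.B (o k)

variable {F n o}

/-- The sign of the determinant of two normals compares their angles, which is transitive because
all angles are in [0, π). -/
theorem Before.trans (hF : F.Upright n) {i j k : ℕ} (hi : i < n) (hj : j < n) (hk : k < n)
    (hij : F.Before i j) (hjk : F.Before j k) : F.Before i k := by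
  -- The second conclusion handles ties: parallel outer vectors force both steps to be ties, so that
  -- the indices can be chained.
  have key : ∀ a b a' b' a'' b'' : ℝ, (0 < b ∨ b = 0 ∧ 0 < a) → (0 < b' ∨ b' = 0 ∧ 0 < a') →
      (0 < b'' ∨ b'' = 0 ∧ 0 < a'') → b * a' ≤ a * b' → b' * a'' ≤ a' * b'' →
      b * a'' ≤ a * b'' ∧ (b * a'' = a * b'' → b * a' = a * b' ∧ b' * a'' = a' * b'') := by
    intro a b a' b' a'' b'' h h' h'' h₁ h₂
    rcases h' with h' | ⟨rfl, h'⟩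
    · have hb : 0 ≤ b := by rcases h with h | h <;> linarith
      have hb'' : 0 ≤ b'' := by rcases h'' with h | h <;> linarith
      -- Three plane vectors are dependent; in this relation between their determinants all
      -- coefficients `b`, `b'`, `b''` are nonnegative.
      have e : b' * (a * b'' - b * a'') =
        (a * b' - b * a') * b'' + b * (a' * b'' - b' * a'') := by ring
      have p1 := mul_nonneg (sub_nonneg.2 h₁) hb''
      have p2 := mul_nonneg hb (sub_nonneg.2 h₂)
      refine ⟨?_, fun h0 => ?_⟩
      · by_contra hc
        nlinarith
      · rw [h0] at e
        have q1 : (a * b' - b * a') * b'' = 0 := by linarith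
        have q2 : b * (a' * b'' - b' * a'') = 0 := by linarith
        rcases h with h | ⟨rfl, h⟩
        · have : a' * b'' - b' * a'' = 0 := by
            rcases mul_eq_zero.1 q2 with q | q
            · exact absurd q h.ne'
            · exact q
          rcases h'' with h'' | ⟨rfl, h''⟩
          · rcases mul_eq_zero.1 q1 with q | q
            · exact ⟨by linarith, by linarith⟩
            · exact absurd q h''.ne'
          · nlinarith
        · have : a * b'' = 0 := by linarith
          rcases mul_eq_zero.1 this with q | q
          · exact absurd q h.ne'
          · subst q
            nlinarith [h''.resolve_left (lt_irrefl _)]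
    · have hb : b = 0 := by
        rcases h with h | h
        · nlinarith
        · exact h.1
      subst hb
      have ha : 0 < a := by simpa using h
      rcases h'' with h'' | ⟨rfl, h''⟩
      · exact ⟨by nlinarith, fun h0 => by nlinarith⟩
      · simp
  have := key _ _ _ _ _ _ (hF i hi) (hF j hj) (hF k hk)
    (hij.elim le_of_lt fun h => h.1.le) (hjk.elim le_of_lt fun h => h.1.le)
  rcases this.1.lt_or_eq with h | h
  · exact Or.inl h
  · obtain ⟨h1, h2⟩ := this.2 h
    refine Or.inr ⟨h, ?_⟩
    have h3 : i < j := by rcases hij with h | h; exacts [absurd h1 h.ne, h.2]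
    have h4 : j < k := by rcases hjk with h | h; exacts [absurd h2 h.ne, h.2]
    exact h3.trans h4

theorem not_before_self (i : ℕ) : ¬ F.Before i i := by
  simp [Before, mul_comm]

theorem before_or_before {i j : ℕ} (h : i ≠ j) : F.Before i j ∨ F.Before j i := by
  unfold Before
  rcases lt_trichotomy (F.B i * F.A j) (F.A i * F.B j) with h1 | h1 | h1
  · exact Or.inl (Or.inl h1)
  · rcases lt_or_gt_of_ne h with h2 | h2
    · exact Or.inl (Or.inr ⟨h1, h2⟩)
    · exact Or.inr (Or.inr ⟨by linarith, h2⟩)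
  · exact Or.inr (Or.inl (by linarith))

/-- The predecessors of `i` are predecessors of `j` by transitivity, and `i` itself is a further
one. -/
theorem rank_lt_rank (hF : F.Upright n) {i j : ℕ} (hi : i < n) (hj : j < n)
    (h : F.Before i j) : F.rank n i < F.rank n j := by
  classical
  refine Finset.card_lt_card ((Finset.ssubset_iff_of_subset fun k hk => ?_).2 ⟨i, ?_, ?_⟩)
  · rw [Finset.mem_filter, Finset.mem_range] at hk ⊢
    exact ⟨hk.1, hk.2.trans hF hk.1 hi hj h⟩
  · simp [hi, h]
  · simp [not_before_self]

theorem rank_lt {i : ℕ} (hi : i < n) : F.rank n i < n := by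
  classical
  have : F.rank n i < (Finset.range n).card :=
    Finset.card_lt_card ((Finset.ssubset_iff_of_subset (Finset.filter_subset _ _)).2
      ⟨i, by simpa using hi, by simp [not_before_self]⟩)
  simpa using this

/-- The left inverse `o` makes `rank` injective on a finite set, hence a permutation of which `o` is
the inverse. An inversion in `o` would contradict the monotonicity of `rank`. -/
theorem sorted_of_rank (hF : F.Upright n) (ho : ∀ i < n, o (F.rank n i) = i) :
    F.Sorted n o := by
  have hmaps : Set.MapsTo (F.rank n) (Finset.range n) (Finset.range n) := fun i hi => by
    simp at hi ⊢; exact rank_lt hi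
  have hinj : Set.InjOn (F.rank n) (Finset.range n : Finset ℕ) := by
    intro i hi j hj hij
    have := ho i (by simpa using hi)
    rw [hij, ho j (by simpa using hj)] at this
    exact this.symm
  have hsurj := Finset.surjOn_of_injOn_of_card_le _ hmaps hinj le_rfl
  have hinv : ∀ k < n, ∃ i < n, F.rank n i = k ∧ o k = i := by
    intro k hk
    obtain ⟨i, hi, rfl⟩ := hsurj (by simpa using hk : k ∈ (Finset.range n : Set ℕ))
    have hi' : i < n := by simpa using hi
    exact ⟨i, hi', rfl, ho i hi'⟩
  refine ⟨⟨?_, ?_, ?_⟩, ?_⟩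
  · intro k hk
    obtain ⟨i, hi, -, h⟩ := hinv k (by simpa using hk)
    simpa [h] using hi
  · intro k hk l hl hkl
    obtain ⟨i, hi, h1, h2⟩ := hinv k (by simpa using hk)
    obtain ⟨j, hj, h3, h4⟩ := hinv l (by simpa using hl)
    rw [← h1, ← h3, ← h2, ← h4, hkl]
  · intro i hi
    have hi' : i < n := by simpa using hi
    exact ⟨F.rank n i, by simpa using rank_lt hi', ho i hi'⟩
  · intro j k hjk hk
    obtain ⟨i, hi, h1, h2⟩ := hinv k hk
    obtain ⟨l, hl, h3, h4⟩ := hinv j (hjk.trans_lt hk)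
    rw [h2, h4]
    by_contra hc
    have : F.Before i l := Or.inl (by linarith)
    have := rank_lt_rank hF hi hl this
    omega

/-- The signed distance from the line `l` grows on the way from the point `u` to the point `v`. -/
def Rising (F : Frame) (u v l : ℕ) : Prop :=
  0 < F.A l * (F.X v - F.X u) + F.B l * (F.Y v - F.Y u)

theorem rising_iff {u v l : ℕ} : F.Rising u v l ↔ F.side l u < F.side l v := by
  unfold Rising side
  constructor <;> intro h <;> linarith

/-- The direction from `u` to `v` is in the half-open right half-plane. -/
def Rightward (F : Frame) (u v : ℕ) : Prop :=
  F.X u < F.X v ∨ F.X u = F.X v ∧ F.Y v ≤ F.Y u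

/-- A line rises iff its normal makes an angle below π/2 with the direction. With direction angle φ
in [-π/2, π/2), the normals in [0, π) that do so are those with angle in [0, φ + π/2), which is
closed under passing to smaller angles. If the two points coincide, nothing rises. -/
theorem Rising.of_le (hF : F.Upright n) {u v i j : ℕ} (hi : i < n) (hj : j < n)
    (huv : F.Rightward u v) (hij : F.B i * F.A j ≤ F.A i * F.B j) (h : F.Rising u v j) :
    F.Rising u v i := by
  have h1 := hF i hi
  have h2 := hF j hj
  unfold Rising Rightward at *
  generalize F.A i = a at *
  generalize F.B i = b at *
  generalize F.A j = a' at *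
  generalize F.B j = b' at *
  obtain ⟨dx, hdx⟩ : ∃ dx, dx = F.X v - F.X u := ⟨_, rfl⟩
  obtain ⟨dy, hdy⟩ : ∃ dy, dy = F.Y v - F.Y u := ⟨_, rfl⟩
  have huv' : 0 < dx ∨ dx = 0 ∧ dy ≤ 0 := by
    rcases huv with h | h
    · left; linarith
    · right; constructor <;> linarith [h.1, h.2]
  rw [← hdx, ← hdy] at h ⊢
  clear huv hdx hdy hF hi hj
  rcases h2 with h2 | ⟨rfl, h2⟩
  · have e : b' * (a * dx + b * dy) = (a * b' - b * a') * dx + b * (a' * dx + b' * dy) := by ring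
    have hdx : 0 ≤ dx := by rcases huv' with h | h <;> linarith
    have p1 := mul_nonneg (sub_nonneg.2 hij) hdx
    have : 0 < b' * (a * dx + b * dy) := by
      rcases h1 with h1 | ⟨rfl, h1⟩
      · rw [e]; have := mul_pos h1 h; linarith
      · rcases huv' with h3 | ⟨rfl, h3⟩
        · have := mul_pos h2 (mul_pos h1 h3); linarith
        · nlinarith
    exact pos_of_mul_pos_right this h2.le
  · have hb : b = 0 := by
      rcases h1 with h1 | h1
      · nlinarith
      · exact h1.1
    subst hb
    have ha : 0 < a := by simpa using h1
    have hdx : 0 < dx := by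
      have : 0 < a' * dx := by linarith
      exact pos_of_mul_pos_right this h2.le
    have := mul_pos ha hdx
    linarith

open Classical in
/-- The number of lines among the first `k` in the order `o` that have the point `p` on their
negative side. -/
noncomputable def neg (F : Frame) (o : ℕ → ℕ) (p k : ℕ) : ℕ :=
  ((Finset.range k).filter fun j => F.side (o j) p < 0).card

open Classical in
/-- The number of lines among the first `k` in the order `o` that have the point `p` on their
positive side. -/
noncomputable def pos (F : Frame) (o : ℕ → ℕ) (p k : ℕ) : ℕ :=
  ((Finset.range k).filter fun j => 0 < F.side (o j) p).card

open Classical in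
/-- The number of lines that have `p` and `q` strictly on the same side. -/
noncomputable def agree (F : Frame) (n p q : ℕ) : ℕ :=
  ((Finset.range n).filter fun l =>
    F.side l p < 0 ∧ F.side l q < 0 ∨ 0 < F.side l p ∧ 0 < F.side l q).card

theorem agree_comm (p q : ℕ) : F.agree n p q = F.agree n q p := by
  unfold agree
  congr 1
  ext l
  simp only [Finset.mem_filter]
  tauto

theorem card_filter_range_succ (P : ℕ → Prop) [DecidablePred P] (k : ℕ) :
    ((Finset.range (k + 1)).filter P).card =
      ((Finset.range k).filter P).card + if P k then 1 else 0 := by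
  rw [Finset.range_add_one, Finset.filter_insert]
  split_ifs with h
  · rw [Finset.card_insert_of_notMem (by simp)]
  · rfl

theorem neg_zero (p : ℕ) : F.neg o p 0 = 0 := by simp [neg]
theorem pos_zero (p : ℕ) : F.pos o p 0 = 0 := by simp [pos]

theorem neg_succ (p k : ℕ) [Decidable (F.side (o k) p < 0)] :
    F.neg o p (k + 1) = F.neg o p k + if F.side (o k) p < 0 then 1 else 0 := by
  unfold neg; classical rw [card_filter_range_succ]; congr

theorem pos_succ (p k : ℕ) [Decidable (0 < F.side (o k) p)] :
    F.pos o p (k + 1) = F.pos o p k + if 0 < F.side (o k) p then 1 else 0 := by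
  unfold pos; classical rw [card_filter_range_succ]; congr

theorem neg_le (p k : ℕ) : F.neg o p k ≤ k :=
  (Finset.card_filter_le _ _).trans (by simp)

theorem pos_le (p k : ℕ) : F.pos o p k ≤ k :=
  (Finset.card_filter_le _ _).trans (by simp)

theorem neg_mono (p : ℕ) {k m : ℕ} (h : k ≤ m) : F.neg o p k ≤ F.neg o p m :=
  Finset.card_le_card (Finset.filter_subset_filter _ (by simpa using h))

theorem pos_mono (p : ℕ) {k m : ℕ} (h : k ≤ m) : F.pos o p k ≤ F.pos o p m :=
  Finset.card_le_card (Finset.filter_subset_filter _ (by simpa using h))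

theorem agree_le (p q : ℕ) : F.agree n p q ≤ n :=
  (Finset.card_filter_le _ _).trans (by simp)

/-- The larger value decides whether both are negative, the smaller one whether both are positive,
and the two cases exclude each other. -/
theorem ite_same_sign_of_lt {x y : ℝ} (h : x < y) :
    (if x < 0 ∧ y < 0 ∨ 0 < x ∧ 0 < y then 1 else 0) =
      (if y < 0 then 1 else 0) + (if 0 < x then 1 else 0) := by
  split_ifs <;> first | rfl | (exfalso; grind)

theorem ite_same_sign_of_le {x y : ℝ} (h : y ≤ x) :
    (if x < 0 ∧ y < 0 ∨ 0 < x ∧ 0 < y then 1 else 0) =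
      (if x < 0 then 1 else 0) + (if 0 < y then 1 else 0) := by
  split_ifs <;> first | rfl | (exfalso; grind)

/-- Sums the two `ite_same_sign` identities over the positions below `k` and from `k` on; the latter
counts are differences of prefix counts. -/
theorem agree_eq (ho : F.Sorted n o) {u v k : ℕ} (hk : k ≤ n)
    (hlo : ∀ j < k, F.Rising u v (o j)) (hhi : ∀ j, k ≤ j → j < n → ¬ F.Rising u v (o j)) :
    F.agree n u v = F.neg o v k + F.pos o u k + (F.neg o u n - F.neg o u k) +
      (F.pos o v n - F.pos o v k) := by
  classical
  set P : ℕ → Prop := fun j => F.side (o j) u < 0 ∧ F.side (o j) v < 0 ∨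
    0 < F.side (o j) u ∧ 0 < F.side (o j) v with hP
  -- Counting lines becomes counting positions, as `o` is a bijection.
  have h0 : F.agree n u v = ((Finset.range n).filter P).card := by
    symm
    refine Finset.card_bij (fun j _ => o j) ?_ ?_ ?_
    · intro j hj
      simp only [Finset.mem_filter] at hj ⊢
      exact ⟨ho.bij.mapsTo hj.1, hj.2⟩
    · intro i hi j hj hij
      simp only [Finset.mem_filter] at hi hj
      exact ho.bij.injOn hi.1 hj.1 hij
    · intro l hl
      simp only [Finset.mem_filter] at hl
      obtain ⟨j, hj, rfl⟩ := ho.bij.surjOn hl.1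
      exact ⟨j, by simp only [Finset.mem_filter]; exact ⟨hj, hl.2⟩, rfl⟩
  have h1 : ∀ m ≤ k, ((Finset.range m).filter P).card = F.neg o v m + F.pos o u m := by
    intro m
    induction m with
    | zero => simp [neg, pos]
    | succ m ih =>
      intro hm
      rw [card_filter_range_succ, ih (by omega), neg_succ, pos_succ]
      have := ite_same_sign_of_lt (rising_iff.1 (hlo m (by omega)))
      simp only [hP] at this ⊢
      omega
  -- The subtracted terms are moved to the left to avoid truncated subtraction in the induction.
  have h2 : ∀ d, k + d ≤ n → ((Finset.range (k + d)).filter P).card + F.neg o u k + F.pos o v k =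
      F.neg o v k + F.pos o u k + F.neg o u (k + d) + F.pos o v (k + d) := by
    intro d
    induction d with
    | zero => intro _; rw [Nat.add_zero, h1 k le_rfl]
    | succ d ih =>
      intro hd
      have := ih (by omega)
      rw [← Nat.add_assoc, card_filter_range_succ, neg_succ, pos_succ]
      have h3 := ite_same_sign_of_le (not_lt.1 (mt rising_iff.2 (hhi (k + d) (by omega) (by omega))))
      simp only [hP] at h3 this ⊢
      omega
  have h3 := h2 (n - k) (by omega)
  rw [Nat.add_sub_cancel' hk] at h3
  have := F.neg_mono (o := o) u hk
  have := F.pos_mono (o := o) v hk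
  omega

/-- The frame describes the input, up to the signs of the equations of the lines. -/
structure Describes (F : Frame) (I : Input n) : Prop where
  line : ∀ i : Fin n, (F.A i = I.a i ∧ F.B i = I.b i ∧ F.C i = I.c i) ∨
    (F.A i = -I.a i ∧ F.B i = -I.b i ∧ F.C i = -I.c i)
  x : ∀ i : Fin n, F.X i = I.pt i 0
  y : ∀ i : Fin n, F.Y i = I.pt i 1

end Frame

/-! ### Crossing distance in terms of sides -/

/-- The equation of the line is affine along the segment, with end values `f` and `g`; it vanishes
somewhere unless both have the same strict sign. -/
theorem lineOf_inter_segment_nonempty_iff (a b c : ℝ) (p q : Plane) :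
    (lineOf a b c ∩ segment ℝ p q).Nonempty ↔
      ¬ (a * p 0 + b * p 1 - c < 0 ∧ a * q 0 + b * q 1 - c < 0 ∨
        0 < a * p 0 + b * p 1 - c ∧ 0 < a * q 0 + b * q 1 - c) := by
  obtain ⟨f, hf⟩ : ∃ f, f = a * p 0 + b * p 1 - c := ⟨_, rfl⟩
  obtain ⟨g, hg⟩ : ∃ g, g = a * q 0 + b * q 1 - c := ⟨_, rfl⟩
  rw [← hf, ← hg]
  have hpt : ∀ s t : ℝ, s + t = 1 →
      (s • p + t • q ∈ lineOf a b c ↔ s * f + t * g = 0) := by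
    intro s t hst
    have : s * f + t * g = a * (s * p 0 + t * q 0) + b * (s * p 1 + t * q 1) - (s + t) * c := by
      rw [hf, hg]; ring
    rw [this, hst, one_mul, sub_eq_zero]
    rfl
  constructor
  · rintro ⟨z, hz, s, t, hs, ht, hst, rfl⟩
    rw [hpt s t hst] at hz
    rintro (⟨h1, h2⟩ | ⟨h1, h2⟩)
    · rcases hs.eq_or_lt with rfl | hs
      · have : t = 1 := by linarith
        subst this; linarith
      · nlinarith
    · rcases hs.eq_or_lt with rfl | hs
      · have : t = 1 := by linarith
        subst this; linarith
      · nlinarith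
  · intro h
    by_cases hfg : f = g
    · have hf0 : f = 0 := by
        by_contra h0
        rcases lt_or_gt_of_ne h0 with h1 | h1
        · exact h (Or.inl ⟨h1, hfg ▸ h1⟩)
        · exact h (Or.inr ⟨h1, hfg ▸ h1⟩)
      exact ⟨_, (hpt 1 0 (by norm_num)).2 (by rw [hf0]; ring), 1, 0, by norm_num, by norm_num,
        by norm_num, rfl⟩
    · have hne : f - g ≠ 0 := sub_ne_zero.2 hfg
      -- The weights of the zero of the affine function with values `f ≠ g` at the ends.
      have h1 : -g / (f - g) + f / (f - g) = 1 := by field_simp; ring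
      refine ⟨_, (hpt (-g / (f - g)) (f / (f - g)) h1).2 (by field_simp; ring), _, _, ?_, ?_, h1,
        rfl⟩
      · rcases lt_or_gt_of_ne hfg with h2 | h2
        · exact div_nonneg_of_nonpos (by by_contra; grind) (by linarith)
        · exact div_nonneg (by by_contra; grind) (by linarith)
      · rcases lt_or_gt_of_ne hfg with h2 | h2
        · exact div_nonneg_of_nonpos (by by_contra; grind) (by linarith)
        · exact div_nonneg (by by_contra; grind) (by linarith)

/-- Each line either meets the segment or has both ends strictly on one side. Negating an equation
only swaps the two sides, so the signs in the frame do not matter. -/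
theorem Frame.Describes.crossingDist_add_agree {n : ℕ} {F : Frame} {I : Input n}
    (h : F.Describes I) (i j : Fin n) :
    crossingDist I.lines (I.pt i) (I.pt j) + F.agree n i j = n := by
  classical
  set P : Fin n → Prop := fun l => F.side l i < 0 ∧ F.side l j < 0 ∨
    0 < F.side l i ∧ 0 < F.side l j with hP
  have h1 : F.agree n i j = (Finset.univ.filter P).card := by
    symm
    refine Finset.card_bij (fun l _ => (l : ℕ)) ?_ ?_ ?_
    · intro l hl
      simp only [Finset.mem_filter, Finset.mem_range] at hl ⊢
      exact ⟨l.2, hl.2⟩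
    · intro a _ b _ hab
      exact Fin.ext hab
    · intro l hl
      simp only [Finset.mem_filter, Finset.mem_range] at hl
      exact ⟨⟨l, hl.1⟩, by simpa [hP] using hl.2, rfl⟩
  have h2 : crossingDist I.lines (I.pt i) (I.pt j) = (Finset.univ.filter fun l => ¬ P l).card := by
    unfold crossingDist
    -- The lines of the input are distinct as sets, so lines may be counted by index.
    rw [← Set.ncard_coe_finset, ← Set.ncard_image_of_injective _ I.lines_distinct]
    congr 1
    ext l
    have key : ∀ m : Fin n, (lineOf (I.a m) (I.b m) (I.c m) ∩
        segment ℝ (I.pt i) (I.pt j)).Nonempty ↔ ¬ P m := by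
      intro m
      rw [lineOf_inter_segment_nonempty_iff, not_iff_not]
      simp only [hP, Frame.side, h.x, h.y]
      rcases h.line m with ⟨h1, h2, h3⟩ | ⟨h1, h2, h3⟩
      · rw [h1, h2, h3]
      · rw [h1, h2, h3]
        constructor
        · rintro (⟨h1, h2⟩ | ⟨h1, h2⟩)
          · right; constructor <;> linarith
          · left; constructor <;> linarith
        · rintro (⟨h1, h2⟩ | ⟨h1, h2⟩)
          · right; constructor <;> linarith
          · left; constructor <;> linarith
    simp only [Input.lines, Set.mem_ofPred_eq, Set.mem_range, Set.mem_image, Finset.coe_filter,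
      Finset.mem_univ, true_and]
    constructor
    · rintro ⟨⟨m, rfl⟩, hm⟩
      exact ⟨m, (key m).1 hm, rfl⟩
    · rintro ⟨m, hm, rfl⟩
      exact ⟨⟨m, rfl⟩, (key m).2 hm⟩
  rw [h1, h2, add_comm, Finset.card_filter_add_card_filter_not, Finset.card_univ, Fintype.card_fin]

end CrossingMST

/-! ### Preprocessing programs: orientation, sorting, prefix tables -/

namespace RealRAM

theorem State.updNArr_narr_of_ne (s : State) (A i v : ℕ) {B : ℕ} (h : B ≠ A) :
    (s.updNArr A i v).narr B = s.narr B := by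
  funext j; simp [h]

theorem State.updRArr_rarr_of_ne (s : State) (A i : ℕ) (v : ℝ) {B : ℕ} (h : B ≠ A) :
    (s.updRArr A i v).rarr B = s.rarr B := by
  funext j; simp [h]

/-- Disjunction of tests. -/
def Test.or (b c : Test) : Test := .not (.and (.not b) (.not c))

@[simp] theorem Test.or_holds (b c : Test) (s : State) :
    (b.or c).Holds s ↔ b.Holds s ∨ c.Holds s := by
  simp only [Test.or, Test.Holds]; tauto

@[simp] theorem Test.or_ok (b c : Test) (W : ℕ) (s : State) :
    (b.or c).Ok W s ↔ b.Ok W s ∧ c.Ok W s := Iff.rfl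

end RealRAM

namespace CrossingMST
open RealRAM

/-- The frame in the real arrays `3, …, 7`. -/
def frameOf (R : ℕ → ℕ → ℝ) : Frame := ⟨R 5, R 6, R 7, R 3, R 4⟩

/-- Orients the equations of the lines such that their normal vectors are in the upper half-plane. -/
def normalizeLines : Prog :=
  .forTo 1 (.reg 0)
    (.ite (.or (.rlt (.get 1 (.reg 1)) (.const 0))
        (.and (.not (.rlt (.const 0) (.get 1 (.reg 1)))) (.rlt (.get 0 (.reg 1)) (.const 0))))
      (.seq (.setRArr 5 (.reg 1) (.sub (.const 0) (.get 0 (.reg 1))))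
        (.seq (.setRArr 6 (.reg 1) (.sub (.const 0) (.get 1 (.reg 1))))
          (.setRArr 7 (.reg 1) (.sub (.const 0) (.get 2 (.reg 1))))))
      (.seq (.setRArr 5 (.reg 1) (.get 0 (.reg 1)))
        (.seq (.setRArr 6 (.reg 1) (.get 1 (.reg 1)))
          (.setRArr 7 (.reg 1) (.get 2 (.reg 1))))))

theorem runs_normalizeLines {n W : ℕ} (I : Input n) (hn : n ≤ W) :
    Runs W normalizeLines I.initial ((n + 1) * 80) fun s =>
      s.nreg 0 = n ∧ s.narr = (fun _ _ => 0) ∧ (frameOf s.rarr).Upright n ∧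
        (frameOf s.rarr).Describes I := by
  set R := I.initial.rarr with hR
  refine Runs.forTo (c := 70) (N := n) (fun m s => s.nreg 0 = n ∧ s.nreg 1 = m ∧
      s.narr = (fun _ _ => 0) ∧ s.rarr 0 = R 0 ∧ s.rarr 1 = R 1 ∧ s.rarr 2 = R 2 ∧
      s.rarr 3 = R 3 ∧ s.rarr 4 = R 4 ∧ ∀ i < m,
        ((s.rarr 5 i = R 0 i ∧ s.rarr 6 i = R 1 i ∧ s.rarr 7 i = R 2 i) ∨
          (s.rarr 5 i = - R 0 i ∧ s.rarr 6 i = - R 1 i ∧ s.rarr 7 i = - R 2 i)) ∧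
        ¬ (s.rarr 6 i < 0 ∨ ¬ 0 < s.rarr 6 i ∧ s.rarr 5 i < 0)) hn ?_ ?_ ?_ ?_ ?_
  · simp [Input.initial, hR]
  · rintro m s hm ⟨h0, h1, -⟩
    exact ⟨h1, trivial, h0⟩
  · rintro m s hm ⟨h0, h1, h2, h3, h4, h5, h6, h7, h8⟩ -
    refine Runs.of_wp ?_ (by decide)
    simp only [wp, NExpr.Ok, RExpr.Ok, Test.Ok, Test.Holds, RExpr.eval, NExpr.eval, Test.or_holds,
      Test.or_ok, h1, State.updRArr_nreg, State.updNReg_nreg, State.updNReg_narr,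
      State.updNReg_rarr, State.updRArr_narr, Int.cast_zero, zero_sub, true_and, and_true]
    refine ⟨fun hb => ?_, fun hb => ?_⟩
    · simp only [h3, h4] at hb
      simp [State.updRArr_rarr_of_ne, h0, h2, h3, h4, h5, h6, h7]
      intro i hi
      rcases eq_or_ne i m with rfl | hne
      · simp
        rcases hb with h | h
        · exact ⟨h.le, fun h' => absurd h (not_lt.2 h')⟩
        · exact ⟨not_lt.1 h.1, fun _ => h.2.le⟩
      · simpa [hne] using h8 i (by omega)
    · simp only [h3, h4] at hb
      simp [State.updRArr_rarr_of_ne, h0, h2, h3, h4, h5, h6, h7]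
      intro i hi
      rcases eq_or_ne i m with rfl | hne
      · simpa using hb
      · simpa [hne] using h8 i (by omega)
  · rintro s ⟨h0, -, h2, h3, h4, h5, h6, h7, h8⟩
    refine ⟨h0, h2, ?_, ?_, ?_, ?_⟩
    · intro i hi
      obtain ⟨h9, h10⟩ := h8 i hi
      have hnd := I.nondegenerate ⟨i, hi⟩
      have e0 : R 0 i = I.a ⟨i, hi⟩ := by simp [hR, Input.initial, padded, hi]
      have e1 : R 1 i = I.b ⟨i, hi⟩ := by simp [hR, Input.initial, padded, hi]
      rw [← e0, ← e1] at hnd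
      simp only [frameOf]
      -- A nonzero normal for which the flip test fails is upright.
      have h11 : s.rarr 5 i ≠ 0 ∨ s.rarr 6 i ≠ 0 := by
        rcases h9 with ⟨a, b, -⟩ | ⟨a, b, -⟩ <;> rw [a, b] <;> simpa using hnd
      grind
    · intro i
      have := (h8 i i.2).1
      simpa [frameOf, hR, Input.initial, padded] using this
    · intro i
      simp [frameOf, h6, hR, Input.initial, padded]
    · intro i
      simp [frameOf, h7, hR, Input.initial, padded]
  · simp only [NExpr.cost]; omega

/-- Sorts the lines by angle: puts each line into the position that is the number of lines before
it. -/
def sortLines : Prog :=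
  .forTo 1 (.reg 0)
    (.seq (.setNReg 3 (.const 0))
      (.seq (.forTo 2 (.reg 0)
          (.ite (.or
              (.rlt (.mul (.get 6 (.reg 2)) (.get 5 (.reg 1)))
                (.mul (.get 5 (.reg 2)) (.get 6 (.reg 1))))
              (.and (.not (.rlt (.mul (.get 5 (.reg 2)) (.get 6 (.reg 1)))
                (.mul (.get 6 (.reg 2)) (.get 5 (.reg 1))))) (.nlt (.reg 2) (.reg 1))))
            (.setNReg 3 (.add (.reg 3) (.const 1))) .skip))
        (.setNArr 2 (.reg 3) (.reg 1))))

theorem runs_sortLines {n W : ℕ} {R : ℕ → ℕ → ℝ} {s : State} (hn : n < W)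
    (hF : (frameOf R).Upright n) (h0 : s.nreg 0 = n) (hN : s.narr = fun _ _ => 0)
    (hs : s.rarr = R) :
    Runs W sortLines s ((n + 1) * ((n + 1) * 50 + 20)) fun s' =>
      s'.nreg 0 = n ∧ (∀ A, A ≠ 2 → s'.narr A = fun _ => 0) ∧ s'.rarr = R ∧
        (frameOf R).Sorted n (s'.narr 2) := by
  classical
  refine Runs.forTo (c := (n + 1) * 50 + 10) (N := n) (fun m s => s.nreg 0 = n ∧ s.nreg 1 = m ∧
      (∀ A, A ≠ 2 → s.narr A = fun _ => 0) ∧ s.rarr = R ∧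
      ∀ i < m, s.narr 2 ((frameOf R).rank n i) = i) hn.le ?_ ?_ ?_ ?_ ?_
  · simp [h0, hN, hs]
  · rintro m s hm ⟨h0, h1, -⟩
    exact ⟨h1, trivial, h0⟩
  · rintro m s hm ⟨h0, h1, h2, h3, h4⟩ -
    refine Runs.seq (t₁ := 2) (t₂ := (n + 1) * 50 + 5)
      (R := fun s' => s' = s.updNReg 3 0) (Runs.of_wp ?_ (by decide)) ?_ (by omega)
    · simp [wp, NExpr.Ok, NExpr.eval]
    rintro s' rfl
    refine Runs.seq (t₁ := (n + 1) * 50) (t₂ := 5)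
      (R := fun s' => s'.nreg 0 = n ∧ s'.nreg 1 = m ∧ s'.narr = s.narr ∧ s'.rarr = R ∧
        s'.nreg 3 = (frameOf R).rank n m) ?_ ?_ (by omega)
    · refine Runs.forTo (c := 40) (N := n) (fun j s' => s'.nreg 0 = n ∧ s'.nreg 1 = m ∧
        s'.nreg 2 = j ∧ s'.narr = s.narr ∧ s'.rarr = R ∧
        s'.nreg 3 = ((Finset.range j).filter fun j => (frameOf R).Before j m).card) hn.le ?_ ?_ ?_ ?_ ?_
      · simp [h0, h1, h3]
      · rintro j s' hj ⟨h0, h1, h2, -⟩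
        exact ⟨h2, trivial, h0⟩
      · rintro j s' hj ⟨h0', h1', h2', h3', h4', h5'⟩ -
        have hle : ((Finset.range j).filter fun j => (frameOf R).Before j m).card ≤ j :=
          (Finset.card_filter_le _ _).trans (by simp)
        -- Tests only offer strict comparison, so equality is expressed by two failing comparisons.
        have hbef : (frameOf R).Before j m ↔ R 6 j * R 5 m < R 5 j * R 6 m ∨
            ¬ R 5 j * R 6 m < R 6 j * R 5 m ∧ j < m := by
          simp only [Frame.Before, frameOf]
          grind
        refine Runs.of_wp ?_ (by decide)
        simp only [wp, NExpr.Ok, RExpr.Ok, Test.Ok, Test.Holds, RExpr.eval, NExpr.eval,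
          Test.or_holds, Test.or_ok, h0', h1', h2', h3', h4', h5', State.updNReg_nreg,
          State.updNReg_narr, State.updNReg_rarr, true_and, and_true, Frame.card_filter_range_succ,
          ← hbef]
        refine ⟨fun hb => ?_, fun hb => ?_⟩
        · simp [hb]
          omega
        · simp [hb]
      · rintro s' ⟨h0', h1', h2', h3', h4', h5'⟩
        refine ⟨h0', h1', h3', h4', ?_⟩
        rw [h5', Frame.rank]
      · simp only [NExpr.cost]; omega
    · rintro s' ⟨h0', h1', h2', h3', h4'⟩
      refine Runs.of_wp ?_ (by decide)
      simp only [wp, NExpr.Ok, NExpr.eval, h1', h4', true_and]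
      simp [h0', h3', h2', h1']
      refine ⟨fun A hA => ?_, fun i hi => ?_⟩
      · funext j; simp [hA, h2', h2 A hA]
      · rcases eq_or_ne i m with rfl | hne
        · simp
        · have hne' : (frameOf R).rank n i ≠ (frameOf R).rank n m := by
            rcases Frame.before_or_before (F := frameOf R) hne with h | h
            · exact (Frame.rank_lt_rank hF (by omega) hm h).ne
            · exact (Frame.rank_lt_rank hF hm (by omega) h).ne'
          rw [if_neg hne']
          exact h4 i (by omega)
  · rintro s ⟨h0, h1, h2, h3, h4⟩
    exact ⟨h0, h2, h3, Frame.sorted_of_rank hF h4⟩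
  · simp only [NExpr.cost]; ring_nf; omega

/-- Tabulates, for each point, the number of lines with the point on their negative and positive side
among each initial segment of the sorted lines. -/
def countPrefixes : Prog :=
  .forTo 1 (.mul (.reg 0) (.add (.reg 0) (.const 1)))
    (.seq (.setNReg 2 (.div (.reg 1) (.add (.reg 0) (.const 1))))
      (.seq (.setNReg 3 (.sub (.reg 1) (.mul (.reg 2) (.add (.reg 0) (.const 1)))))
        (.ite (.nlt (.const 0) (.reg 3))
          (.seq (.setNReg 4 (.get 2 (.sub (.reg 3) (.const 1))))
            (.seq
              (.ite (.rlt (.sub (.add (.mul (.get 5 (.reg 4)) (.get 3 (.reg 2)))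
                    (.mul (.get 6 (.reg 4)) (.get 4 (.reg 2)))) (.get 7 (.reg 4))) (.const 0))
                (.setNArr 3 (.reg 1) (.add (.get 3 (.sub (.reg 1) (.const 1))) (.const 1)))
                (.setNArr 3 (.reg 1) (.get 3 (.sub (.reg 1) (.const 1)))))
              (.ite (.rlt (.const 0) (.sub (.add (.mul (.get 5 (.reg 4)) (.get 3 (.reg 2)))
                    (.mul (.get 6 (.reg 4)) (.get 4 (.reg 2)))) (.get 7 (.reg 4))))
                (.setNArr 4 (.reg 1) (.add (.get 4 (.sub (.reg 1) (.const 1))) (.const 1)))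
                (.setNArr 4 (.reg 1) (.get 4 (.sub (.reg 1) (.const 1)))))))
          (.seq (.setNArr 3 (.reg 1) (.const 0)) (.setNArr 4 (.reg 1) (.const 0))))))

/-- The contents of the integer arrays `2`, `3`, `4` after the preparation. -/
structure Prepared (n : ℕ) (F : Frame) (o a₃ a₄ : ℕ → ℕ) : Prop where
  sorted : F.Sorted n o
  neg : ∀ p < n, ∀ k ≤ n, a₃ (p * (n + 1) + k) = F.neg o p k
  pos : ∀ p < n, ∀ k ≤ n, a₄ (p * (n + 1) + k) = F.pos o p k

/-- The table with `n` rows of length `n + 1` is filled in one flat loop. Column `0` is the empty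
prefix; any other entry arises from its left neighbour and one side test. -/
theorem runs_countPrefixes {n W : ℕ} {R : ℕ → ℕ → ℝ} {s : State}
    (hW : 4 * ((n + 1) * (n + 1)) ≤ W) (h0 : s.nreg 0 = n)
    (hN : ∀ A, A ≠ 2 → s.narr A = fun _ => 0) (hs : s.rarr = R)
    (ho : (frameOf R).Sorted n (s.narr 2)) :
    Runs W countPrefixes s ((n + 1) * (n + 1) * 130) fun s' =>
      s'.nreg 0 = n ∧ (∀ A, 4 < A → s'.narr A = fun _ => 0) ∧ s'.rarr = R ∧
        Prepared n (frameOf R) (s'.narr 2) (s'.narr 3) (s'.narr 4) := by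
  classical
  set o := s.narr 2 with ho'
  have hexp : n * (n + 1) + (n + 1) = (n + 1) * (n + 1) := by ring
  refine Runs.forTo (c := 110) (N := n * (n + 1)) (fun m s => s.nreg 0 = n ∧ s.nreg 1 = m ∧
      (∀ A, 4 < A → s.narr A = fun _ => 0) ∧ s.rarr = R ∧ s.narr 2 = o ∧
      ∀ x < m, s.narr 3 x = (frameOf R).neg o (x / (n + 1)) (x % (n + 1)) ∧
        s.narr 4 x = (frameOf R).pos o (x / (n + 1)) (x % (n + 1))) (by omega) ?_ ?_ ?_ ?_ ?_
  · simp only [State.updNReg_nreg, State.updNReg_narr, State.updNReg_rarr, h0, hs]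
    simp
    exact ⟨fun A hA => hN A (by omega), ho'.symm⟩
  · rintro m s hm ⟨h0, h1, -⟩
    refine ⟨h1, ?_, ?_⟩
    · simp only [NExpr.Ok, NExpr.eval, h0, true_and]
      omega
    · simp only [NExpr.eval, h0]
  · rintro m s hm ⟨h0, h1, h2, h3, h4, h5⟩ -
    have hdm : n.succ * (m / (n + 1)) + m % (n + 1) = m := Nat.div_add_mod m (n + 1)
    have hmod : m % (n + 1) < n + 1 := Nat.mod_lt _ (by omega)
    have hsub : m - m / (n + 1) * (n + 1) = m % (n + 1) := by
      rw [mul_comm]; have : (n + 1) * (m / (n + 1)) + m % (n + 1) = m := hdm; omega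
    have hmul : m / (n + 1) * (n + 1) ≤ m := Nat.div_mul_le_self m (n + 1)
    refine Runs.of_wp ?_ (by decide)
    simp only [wp, NExpr.Ok, RExpr.Ok, Test.Ok, Test.Holds, RExpr.eval, NExpr.eval, h0, h1, h3, h4,
      State.updNReg_nreg, State.updNReg_narr, State.updNReg_rarr, State.updNArr_nreg,
      State.updNArr_rarr, Int.cast_zero, true_and, and_true, reduceIte, Nat.reduceEqDiff,
      OfNat.zero_ne_ofNat, OfNat.one_ne_ofNat, zero_ne_one, false_and, hsub, State.updNArr_narr]
    have fin : ∀ (s' : State) (v w : ℕ), s'.narr = s.narr →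
        v = (frameOf R).neg o (m / (n + 1)) (m % (n + 1)) →
        w = (frameOf R).pos o (m / (n + 1)) (m % (n + 1)) →
        (∀ A, 4 < A → ((s'.updNArr 3 m v).updNArr 4 m w).narr A = fun _ => 0) ∧
        ((s'.updNArr 3 m v).updNArr 4 m w).narr 2 = o ∧ ∀ x < m + 1,
          (if x = m then v else s.narr 3 x) = (frameOf R).neg o (x / (n + 1)) (x % (n + 1)) ∧
          (if x = m then w else s.narr 4 x) = (frameOf R).pos o (x / (n + 1)) (x % (n + 1)) := by
      intro s' v w hs' hv hw
      refine ⟨fun A hA => ?_, ?_, fun x hx => ?_⟩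
      · rw [State.updNArr_narr_of_ne _ _ _ _ (by omega), State.updNArr_narr_of_ne _ _ _ _ (by omega),
          hs', h2 A hA]
      · rw [State.updNArr_narr_of_ne _ _ _ _ (by omega), State.updNArr_narr_of_ne _ _ _ _ (by omega),
          hs', h4]
      · rcases eq_or_ne x m with rfl | hne
        · rw [if_pos rfl, if_pos rfl]; exact ⟨hv, hw⟩
        · rw [if_neg hne, if_neg hne]; exact h5 x (by omega)
    refine ⟨by omega, by omega, by omega, fun hk => ⟨by omega, ?_⟩, fun hk => ?_⟩
    · obtain ⟨k, hk'⟩ : ∃ k, m % (n + 1) = k + 1 := ⟨m % (n + 1) - 1, by omega⟩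
      have hlt : k < n + 1 := by omega
      have hm1 : m - 1 = (n + 1) * (m / (n + 1)) + k := by
        have : (n + 1) * (m / (n + 1)) + m % (n + 1) = m := hdm
        omega
      -- As the column is positive, the preceding cell is in the same row.
      have hm2 : (m - 1) / (n + 1) = m / (n + 1) := by
        rw [hm1, Nat.mul_add_div (Nat.succ_pos n), Nat.div_eq_of_lt hlt,
          add_zero]
      have hm3 : (m - 1) % (n + 1) = k := by
        rw [hm1, Nat.mul_add_mod, Nat.mod_eq_of_lt hlt]
      have h6 := h5 (m - 1) (by omega)
      rw [hm2, hm3] at h6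
      have h7 := (frameOf R).neg_le (o := o) (m / (n + 1)) k
      have h8 := (frameOf R).pos_le (o := o) (m / (n + 1)) k
      have h9 := (frameOf R).neg_succ (o := o) (m / (n + 1)) k
      have h10 := (frameOf R).pos_succ (o := o) (m / (n + 1)) k
      have h11 : R 5 (o k) * R 3 (m / (n + 1)) + R 6 (o k) * R 4 (m / (n + 1)) - R 7 (o k) =
        (frameOf R).side (o k) (m / (n + 1)) := rfl
      rw [hk', Nat.add_sub_cancel, h6.1, h6.2, h11]
      rw [hk', h9, h10] at fin
      have hkW : k + 1 ≤ W := by omega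
      have h1W : 1 ≤ W := by omega
      refine ⟨fun hb => ⟨⟨h1W, h1W, by omega⟩, fun hc => ⟨⟨h1W, h1W, by omega⟩, ?_⟩,
        fun hc => ⟨h1W, ?_⟩⟩, fun hb => ⟨h1W, fun hc => ⟨⟨h1W, h1W, by omega⟩, ?_⟩,
        fun hc => ⟨h1W, ?_⟩⟩⟩ <;> exact fin _ _ _ rfl (by simp [hb]) (by simp [hc])
    · have hk0 : m % (n + 1) = 0 := by omega
      refine ⟨by omega, Nat.zero_le _, fin _ _ _ rfl ?_ ?_⟩
      · rw [hk0, Frame.neg_zero]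
      · rw [hk0, Frame.pos_zero]
  · rintro s ⟨h0, h1, h2, h3, h4, h5⟩
    refine ⟨h0, h2, h3, ?_⟩
    rw [h4]
    have key : ∀ p < n, ∀ k ≤ n, p * (n + 1) + k < n * (n + 1) ∧
        (p * (n + 1) + k) / (n + 1) = p ∧ (p * (n + 1) + k) % (n + 1) = k := by
      intro p hp k hk
      refine ⟨?_, ?_, ?_⟩
      · calc p * (n + 1) + k < p * (n + 1) + (n + 1) := by omega
          _ = (p + 1) * (n + 1) := by ring
          _ ≤ n * (n + 1) := Nat.mul_le_mul_right _ hp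
      · rw [mul_comm, Nat.mul_add_div (by omega), Nat.div_eq_of_lt (by omega), add_zero]
      · rw [mul_comm, Nat.mul_add_mod, Nat.mod_eq_of_lt (by omega)]
    refine ⟨ho, fun p hp k hk => ?_, fun p hp k hk => ?_⟩
    · obtain ⟨a, b, c⟩ := key p hp k hk
      rw [(h5 _ a).1, b, c]
    · obtain ⟨a, b, c⟩ := key p hp k hk
      rw [(h5 _ a).2, b, c]
  · simp only [NExpr.cost]; nlinarith

end CrossingMST

/-! ### The distance query in logarithmic time -/

namespace CrossingMST
open RealRAM

/-- The test whether the direction from point `u` to point `v` rises on line `l`. -/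
def risingTest (u v : ℕ) (l : NExpr) : Test :=
  .rlt (.const 0) (.add (.mul (.get 5 l) (.sub (.get 3 (.reg v)) (.get 3 (.reg u))))
    (.mul (.get 6 l) (.sub (.get 4 (.reg v)) (.get 4 (.reg u)))))

/-- Puts the points in registers `6` and `7` into registers `10` and `11` in the order of a rightward
direction. -/
def orient : Prog :=
  .ite (.or (.rlt (.get 3 (.reg 6)) (.get 3 (.reg 7)))
      (.and (.not (.rlt (.get 3 (.reg 7)) (.get 3 (.reg 6))))
        (.not (.rlt (.get 4 (.reg 6)) (.get 4 (.reg 7))))))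
    (.seq (.setNReg 10 (.reg 6)) (.seq (.setNReg 11 (.reg 7))
      (.seq (.setNReg 12 (.const 0)) (.setNReg 13 (.reg 0)))))
    (.seq (.setNReg 10 (.reg 7)) (.seq (.setNReg 11 (.reg 6))
      (.seq (.setNReg 12 (.const 0)) (.setNReg 13 (.reg 0)))))

/-- Binary search for the first line in the sorted order that does not rise. -/
def search : Prog :=
  .while (.nlt (.reg 12) (.reg 13))
    (.seq (.setNReg 14 (.div (.add (.reg 12) (.reg 13)) (.const 2)))
      (.ite (risingTest 10 11 (.get 2 (.reg 14)))
        (.setNReg 12 (.add (.reg 14) (.const 1)))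
        (.setNReg 13 (.reg 14))))

/-- The expression for position `k` in the row of the point in register `p`. -/
def rowAt (p k : ℕ) : NExpr := .add (.mul (.reg p) (.add (.reg 0) (.const 1))) (.reg k)

/-- Computes one plus the number of lines that have the points in registers `6` and `7` strictly on
the same side. -/
def countAgree : Prog :=
  .seq orient (.seq search (.setNReg 15
    (.add (.const 1) (.add (.add (.add (.get 3 (rowAt 11 12)) (.get 4 (rowAt 10 12)))
      -- Register `0` holds `n`, so `rowAt p 0` is the last position of the row, the count over all
      -- lines.
      (.sub (.get 3 (rowAt 10 0)) (.get 3 (rowAt 10 12))))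
      (.sub (.get 4 (rowAt 11 0)) (.get 4 (rowAt 11 12)))))))

theorem runs_orient {n W : ℕ} {R : ℕ → ℕ → ℝ} {s : State} (hs : s.rarr = R)
    (h0 : s.nreg 0 = n) :
    Runs W orient s 60 fun s' => s'.narr = s.narr ∧ s'.rarr = R ∧
      (∀ x < 10, s'.nreg x = s.nreg x) ∧ s'.nreg 12 = 0 ∧ s'.nreg 13 = n ∧
      (frameOf R).Rightward (s'.nreg 10) (s'.nreg 11) ∧
      (s'.nreg 10 = s.nreg 6 ∧ s'.nreg 11 = s.nreg 7 ∨
        s'.nreg 10 = s.nreg 7 ∧ s'.nreg 11 = s.nreg 6) := by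
  have hr : ∀ u v, (frameOf R).Rightward u v ↔
      R 3 u < R 3 v ∨ R 3 u = R 3 v ∧ R 4 v ≤ R 4 u := fun _ _ => Iff.rfl
  refine Runs.of_wp ?_ (by decide)
  simp only [orient, wp, NExpr.Ok, RExpr.Ok, Test.Ok, Test.Holds, RExpr.eval, NExpr.eval, Test.or_holds,
      Test.or_ok, hs, State.updNReg_nreg, State.updNReg_narr, State.updNReg_rarr, true_and, and_true,
      hr]
  refine ⟨fun hb => ⟨Nat.zero_le _, fun x hx => ?_, ?_, ?_, ?_, ?_⟩,
    fun hb => ⟨Nat.zero_le _, fun x hx => ?_, ?_, ?_, ?_, ?_⟩⟩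
  · simp; grind
  · simp
  · simp [h0]
  · simp; grind
  · simp
  · simp; grind
  · simp
  · simp [h0]
  · simp; grind
  · simp

/-- Everything below register `12` rises and nothing from register `13` on does; since rising is an
initial segment, one test in the middle discards half of the rest. -/
theorem runs_search {n W : ℕ} {R : ℕ → ℕ → ℝ} {o : ℕ → ℕ} {s : State} {u v : ℕ}
    (hW : 4 * ((n + 1) * (n + 1)) ≤ W) (hF : (frameOf R).Upright n) (ho : (frameOf R).Sorted n o)
    (huv : (frameOf R).Rightward u v) (hs : s.rarr = R) (hn : s.narr 2 = o)
    (hu : s.nreg 10 = u) (hv : s.nreg 11 = v) (hlo : s.nreg 12 = 0) (hhi : s.nreg 13 = n) :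
    Runs W search s ((Nat.log 2 n + 2) * 60) fun s' => s'.narr = s.narr ∧ s'.rarr = R ∧
      (∀ x < 12, s'.nreg x = s.nreg x) ∧ s'.nreg 12 ≤ n ∧
      (∀ j < s'.nreg 12, (frameOf R).Rising u v (o j)) ∧
      ∀ j, s'.nreg 12 ≤ j → j < n → ¬ (frameOf R).Rising u v (o j) := by
  have hnW : 4 * n + 4 ≤ W := by nlinarith
  have hr : ∀ l, (frameOf R).Rising u v l ↔
      0 < R 5 l * (R 3 v - R 3 u) + R 6 l * (R 4 v - R 4 u) := fun _ => Iff.rfl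
  have hmono : ∀ i j, i ≤ j → j < n → (frameOf R).Rising u v (o j) →
      (frameOf R).Rising u v (o i) := by
    intro i j hij hj h
    have hoi := ho.bij.mapsTo (show i ∈ (Finset.range n : Set ℕ) by simp; omega)
    have hoj := ho.bij.mapsTo (show j ∈ (Finset.range n : Set ℕ) by simp; omega)
    exact Frame.Rising.of_le hF (by simpa using hoi) (by simpa using hoj) huv
      (ho.mono i j hij hj) h
  refine (Runs.while_halving (c := 50) (fun s' => s'.narr = s.narr ∧ s'.rarr = R ∧
      (∀ x < 12, s'.nreg x = s.nreg x) ∧ s'.nreg 12 ≤ s'.nreg 13 ∧ s'.nreg 13 ≤ n ∧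
      (∀ j < s'.nreg 12, (frameOf R).Rising u v (o j)) ∧
      ∀ j, s'.nreg 13 ≤ j → j < n → ¬ (frameOf R).Rising u v (o j))
    (fun s' => s'.nreg 13 - s'.nreg 12) ?_ ?_ ?_ ?_ s ?_ (N := n) ?_).mono ?_ fun _ h => h
  · intro s' _
    exact ⟨trivial, trivial⟩
  · intro s' _ hb
    simp only [Test.Holds, NExpr.eval] at hb
    omega
  · rintro s' ⟨h1, h2, h3, h4, h5, h6, h7⟩ hb
    simp only [Test.Holds, NExpr.eval] at hb
    have h8 : s'.nreg 10 = u := by rw [h3 10 (by omega), hu]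
    have h9 : s'.nreg 11 = v := by rw [h3 11 (by omega), hv]
    have h10 : s'.narr 2 = o := by rw [h1, hn]
    refine Runs.of_wp ?_ (by decide)
    generalize hmid : (s'.nreg 12 + s'.nreg 13) / 2 = mid
    have hm1 : s'.nreg 12 ≤ mid := by omega
    have hm2 : mid < s'.nreg 13 := by omega
    simp only [risingTest, wp, NExpr.Ok, RExpr.Ok, Test.Ok, Test.Holds, RExpr.eval, NExpr.eval,
      h2, h8, h9, h10, hmid, Int.cast_zero, State.updNReg_nreg, State.updNReg_narr, State.updNReg_rarr,
      true_and, and_true, reduceIte, Nat.reduceEqDiff, ← hr, h1]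
    refine ⟨by omega, fun hb => ⟨by omega, ⟨fun x hx => ?_, by omega, by omega, fun j hj => ?_, h7⟩,
      by omega⟩, fun hb => ⟨⟨fun x hx => ?_, by omega, by omega, h6, fun j hj hjn hj' => ?_⟩,
      by omega⟩⟩
    · rw [if_neg (by omega), if_neg (by omega), h3 x hx]
    · exact hmono j mid (by omega) (by omega) hb
    · rw [if_neg (by omega), if_neg (by omega), h3 x hx]
    · exact hb (hmono mid j hj hjn hj')
  · rintro s' ⟨h1, h2, h3, h4, h5, h6, h7⟩ hb
    simp only [Test.Holds, NExpr.eval] at hb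
    exact ⟨h1, h2, h3, by omega, h6, fun j hj => h7 j (by omega)⟩
  · refine ⟨rfl, hs, fun _ _ => rfl, by omega, by omega, fun j hj => by omega,
      fun j hj => by omega⟩
  · omega
  · exact Nat.mul_le_mul_left _ (by decide)

theorem runs_countAgree {n W : ℕ} {R : ℕ → ℕ → ℝ} {a₂ a₃ a₄ : ℕ → ℕ} {s : State}
    (hW : 4 * ((n + 1) * (n + 1)) ≤ W) (hF : (frameOf R).Upright n)
    (hP : Prepared n (frameOf R) a₂ a₃ a₄) (h0 : s.nreg 0 = n) (hs : s.rarr = R)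
    (h2 : s.narr 2 = a₂) (h3 : s.narr 3 = a₃) (h4 : s.narr 4 = a₄)
    (h6 : s.nreg 6 < n) (h7 : s.nreg 7 < n) :
    Runs W countAgree s ((Nat.log 2 n + 2) * 130) fun s' => s'.narr = s.narr ∧ s'.rarr = R ∧
      (∀ x < 10, s'.nreg x = s.nreg x) ∧
      s'.nreg 15 = 1 + (frameOf R).agree n (s.nreg 6) (s.nreg 7) := by
  refine Runs.seq (t₁ := 60) (t₂ := (Nat.log 2 n + 2) * 60 + 70) (runs_orient hs h0) ?_ (by omega)
  rintro s₁ ⟨e1, e2, e3, e4, e5, e6, e7⟩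
  refine Runs.seq (t₂ := 70) (runs_search hW hF hP.sorted e6 e2 (by rw [e1, h2]) rfl rfl e4 e5)
    ?_ (by omega)
  rintro s₂ ⟨f1, f2, f3, f4, f5, f6⟩
  have g10 := f3 10 (by omega)
  have g11 := f3 11 (by omega)
  have g0 : s₂.nreg 0 = n := by rw [f3 0 (by omega), e3 0 (by omega), h0]
  obtain ⟨u, hu⟩ : ∃ u, s₁.nreg 10 = u := ⟨_, rfl⟩
  obtain ⟨v, hv⟩ : ∃ v, s₁.nreg 11 = v := ⟨_, rfl⟩
  obtain ⟨k, hk⟩ : ∃ k, s₂.nreg 12 = k := ⟨_, rfl⟩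
  rw [hu, hv] at e6 e7 f5 f6
  rw [hk] at f4 f5 f6
  rw [hu] at g10
  rw [hv] at g11
  have hun : u < n := by omega
  have hvn : v < n := by omega
  -- The possible swap by `orient` is harmless, as `agree` is symmetric.
  have hag : (frameOf R).agree n (s.nreg 6) (s.nreg 7) = (frameOf R).agree n u v := by
    rcases e7 with ⟨rfl, rfl⟩ | ⟨rfl, rfl⟩
    · rfl
    · exact Frame.agree_comm _ _
  have hmul : ∀ p < n, p * (n + 1) + (n + 1) ≤ (n + 1) * (n + 1) := fun p hp => by nlinarith
  have hmu := hmul u hun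
  have hmv := hmul v hvn
  have hN : 4 * n + 4 ≤ W := by nlinarith
  have key := Frame.agree_eq hP.sorted f4 f5 f6
  have i3 : s₂.narr 3 = a₃ := by rw [f1, e1, h3]
  have i4 : s₂.narr 4 = a₄ := by rw [f1, e1, h4]
  have j1 := hP.neg v hvn k f4
  have j2 := hP.pos u hun k f4
  have j3 := hP.neg u hun n le_rfl
  have j4 := hP.neg u hun k f4
  have j5 := hP.pos v hvn n le_rfl
  have j6 := hP.pos v hvn k f4
  have l1 := (frameOf R).agree_le (n := n) u v
  refine Runs.of_wp ?_ (by decide)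
  simp only [rowAt, wp, NExpr.Ok, NExpr.eval, g0, g10, g11, hk, i3, i4, j1, j2, j3, j4, j5, j6, ← key,
    State.updNReg_nreg, State.updNReg_narr, State.updNReg_rarr, true_and, and_true, reduceIte, f2, hag]
  refine ⟨?_, by rw [f1, e1], fun x hx => ?_⟩
  · omega
  · rw [if_neg (by omega), f3 x (by omega), e3 x hx]

end CrossingMST

/-! ### Prim's algorithm on the machine -/

namespace CrossingMST
open RealRAM

/-- `G` is the largest value `g x` over those `x` in the tree `T` with `D x`, attained at the vertex
`p` of the tree unless it is zero. -/
def Best (g : ℕ → ℕ) (n : ℕ) (T : ℕ → ℕ) (D : ℕ → Prop) (G p : ℕ) : Prop :=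
  (∀ x < n, T x ≠ 0 → D x → g x ≤ G) ∧ (G = 0 ∨ p < n ∧ T p ≠ 0 ∧ G = g p)

/-- `D` may fail only at `c`, so once `c` has been compared every tree vertex is covered and `D'` is
arbitrary. -/
theorem Best.of_lt {g : ℕ → ℕ} {n c G p : ℕ} {T : ℕ → ℕ} {D D' : ℕ → Prop}
    (h : Best g n T D G p) (hD : ∀ x, x ≠ c → D x) (hc : c < n) (hT : T c ≠ 0) (hlt : G < g c) :
    Best g n T D' (g c) c := by
  refine ⟨fun x hx hx' _ => ?_, Or.inr ⟨hc, hT, rfl⟩⟩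
  rcases eq_or_ne x c with rfl | hne
  · exact le_rfl
  · exact (h.1 x hx hx' (hD x hne)).trans hlt.le

theorem Best.of_le {g : ℕ → ℕ} {n c G p : ℕ} {T : ℕ → ℕ} {D D' : ℕ → Prop}
    (h : Best g n T D G p) (hD : ∀ x, x ≠ c → D x) (hle : g c ≤ G) : Best g n T D' G p := by
  refine ⟨fun x hx hx' _ => ?_, h.2⟩
  rcases eq_or_ne x c with rfl | hne
  · exact hle
  · exact h.1 x hx hx' (hD x hne)

/-- Updates the candidate edge of the vertex in register `7` after the vertex in register `6` joined
the tree, and compares it with the best candidate so far. -/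
def relax : Prog :=
  .ite (.nlt (.get 5 (.reg 7)) (.const 1))
    (.seq countAgree (.seq
      (.ite (.nlt (.get 6 (.reg 7)) (.reg 15))
        (.seq (.setNArr 6 (.reg 7) (.reg 15)) (.setNArr 7 (.reg 7) (.reg 6))) .skip)
      (.ite (.nlt (.reg 8) (.get 6 (.reg 7)))
        (.seq (.setNReg 8 (.get 6 (.reg 7))) (.setNReg 9 (.reg 7))) .skip)))
    .skip

/-- Finds the best edge from the tree to another vertex. -/
def findEdge : Prog :=
  .seq (.setNReg 8 (.const 0)) (.seq (.setNReg 9 (.const 0)) (.forTo 7 (.reg 0) relax))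

/-- Prim's algorithm. -/
def prim : Prog :=
  .seq (.seq (.setNArr 5 (.const 0) (.const 1)) (.setNReg 6 (.const 0)))
    (.forTo 5 (.sub (.reg 0) (.const 1))
      (.seq findEdge
        (.seq (.setNArr 0 (.reg 5) (.get 7 (.reg 9)))
          (.seq (.setNArr 1 (.reg 5) (.reg 9))
            (.seq (.setNArr 5 (.reg 9) (.const 1)) (.setNReg 6 (.reg 9)))))))

/-- The invariant of the search for the best edge, when the vertices below `j` are done: `T` marks
the tree, and `c` is the last vertex of the tree. -/
structure Scan (g : ℕ → ℕ → ℕ) (n : ℕ) (T : ℕ → ℕ) (c j : ℕ) (G P : ℕ → ℕ) (best arg : ℕ) :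
    Prop where
  cand : ∀ q < n, T q = 0 → Best (g · q) n T (fun x => q < j ∨ x ≠ c) (G q) (P q)
  le : ∀ q < j, T q = 0 → G q ≤ best
  attained : best = 0 ∨ arg < j ∧ T arg = 0 ∧ best = G arg

/-- The value `0` stands for "no candidate". Since `g` is positive (the reason for adding one to
`agree`), it cannot survive while an unreached vertex exists. -/
theorem Scan.finish {g : ℕ → ℕ → ℕ} {n c best arg : ℕ} {T G P : ℕ → ℕ}
    (h : Scan g n T c n G P best arg) (hg : ∀ x y, 0 < g x y) (hc : c < n) (hT : T c ≠ 0)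
    (hq : ∃ q < n, T q = 0) : arg < n ∧ T arg = 0 ∧ P arg < n ∧ T (P arg) ≠ 0 ∧
      ∀ x < n, T x ≠ 0 → ∀ y < n, T y = 0 → g x y ≤ g (P arg) arg := by
  have hle : ∀ x < n, T x ≠ 0 → ∀ y < n, T y = 0 → g x y ≤ best := fun x hx hx' y hy hy' =>
    ((h.cand y hy hy').1 x hx hx' (Or.inl hy)).trans (h.le y hy hy')
  obtain ⟨q, hq, hq'⟩ := hq
  have hb : 0 < best := (hg c q).trans_le (hle c hc hT q hq hq')
  obtain ⟨h1, h2, h3⟩ := h.attained.resolve_left hb.ne'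
  obtain ⟨h4, h5, h6⟩ := (h.cand arg h1 h2).2.resolve_left (by omega)
  refine ⟨h1, h2, h4, h5, fun x hx hx' y hy hy' => ?_⟩
  have := hle x hx hx' y hy hy'
  simp only at h6
  omega

theorem Scan.skip {g : ℕ → ℕ → ℕ} {n c j best arg : ℕ} {T G P : ℕ → ℕ}
    (h : Scan g n T c j G P best arg) (hj : T j ≠ 0) : Scan g n T c (j + 1) G P best arg := by
  refine ⟨fun q hq hq' => ?_, fun q hq hq' => ?_, ?_⟩
  · have hne : q ≠ j := by rintro rfl; exact hj hq'
    have := h.cand q hq hq'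
    exact ⟨fun x hx hx' hd => this.1 x hx hx' (hd.imp_left fun _ => by omega), this.2⟩
  · have hne : q ≠ j := by rintro rfl; exact hj hq'
    exact h.le q (by omega) hq'
  · exact h.attained.imp_right fun h => ⟨by omega, h.2⟩

/-- `hGj` and `hb` describe the outcomes of the two conditionals in `relax`. -/
theorem Scan.step {g : ℕ → ℕ → ℕ} {n c j best arg : ℕ} {T G P G' P' : ℕ → ℕ}
    (h : Scan g n T c j G P best arg) (hj : T j = 0) (hc : c < n) (hTc : T c ≠ 0)
    (hG : ∀ q, q ≠ j → G' q = G q) (hP : ∀ q, q ≠ j → P' q = P q)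
    (hGj : (G j < g c j ∧ G' j = g c j ∧ P' j = c) ∨ (g c j ≤ G j ∧ G' j = G j ∧ P' j = P j))
    (best' arg' : ℕ)
    (hb : (best < G' j ∧ best' = G' j ∧ arg' = j) ∨ (G' j ≤ best ∧ best' = best ∧ arg' = arg)) :
    Scan g n T c (j + 1) G' P' best' arg' := by
  refine ⟨fun q hq hq' => ?_, fun q hq hq' => ?_, ?_⟩
  · have hb := h.cand q hq hq'
    rcases eq_or_ne q j with rfl | hne
    · rcases hGj with ⟨h1, h2, h3⟩ | ⟨h1, h2, h3⟩
      · rw [h2, h3]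
        exact hb.of_lt (g := (g · q)) (fun x hx => Or.inr hx) hc hTc h1
      · rw [h2, h3]
        exact hb.of_le (fun x hx => Or.inr hx) h1
    · rw [hG q hne, hP q hne]
      exact ⟨fun x hx hx' hd => hb.1 x hx hx' (hd.imp_left fun _ => by omega), hb.2⟩
  · rcases eq_or_ne q j with rfl | hne
    · omega
    · have := h.le q (by omega) hq'
      rw [hG q hne]
      omega
  · rcases hb with ⟨h1, rfl, rfl⟩ | ⟨h1, rfl, rfl⟩
    · exact Or.inr ⟨by omega, hj, rfl⟩
    · refine h.attained.imp_right fun ⟨h2, h3, h4⟩ => ⟨by omega, h3, ?_⟩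
      rw [hG _ (by omega), h4]

theorem runs_relax {n W : ℕ} {R : ℕ → ℕ → ℝ} {a₂ a₃ a₄ : ℕ → ℕ} {s : State} {c j : ℕ} {T : ℕ → ℕ}
    (hW : 4 * ((n + 1) * (n + 1)) ≤ W) (hF : (frameOf R).Upright n)
    (hP : Prepared n (frameOf R) a₂ a₃ a₄) (h0 : s.nreg 0 = n) (hs : s.rarr = R)
    (h2 : s.narr 2 = a₂) (h3 : s.narr 3 = a₃) (h4 : s.narr 4 = a₄) (h5 : s.narr 5 = T)
    (h6 : s.nreg 6 = c) (h7 : s.nreg 7 = j) (hc : c < n) (hj : j < n) (hT : T c ≠ 0)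
    (hS : Scan (fun x y => 1 + (frameOf R).agree n x y) n T c j (s.narr 6) (s.narr 7)
      (s.nreg 8) (s.nreg 9)) :
    Runs W relax s ((Nat.log 2 n + 2) * 130 + 50) fun s' => s'.rarr = R ∧
      (∀ x < 8, s'.nreg x = s.nreg x) ∧ (∀ A, A ≠ 6 → A ≠ 7 → s'.narr A = s.narr A) ∧
      Scan (fun x y => 1 + (frameOf R).agree n x y) n T c (j + 1) (s'.narr 6) (s'.narr 7)
        (s'.nreg 8) (s'.nreg 9) := by
  have hnW : 4 * n + 4 ≤ W := by nlinarith
  refine Runs.ite (c := (Nat.log 2 n + 2) * 130 + 40) ⟨trivial, ?_⟩ (fun hb => ?_) (fun hb => ?_) ?_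
  · simp only [NExpr.Ok]; omega
  · simp only [Test.Holds, NExpr.eval, h7, h5, Nat.lt_one_iff] at hb
    refine Runs.seq (t₂ := 40) (runs_countAgree hW hF hP h0 hs h2 h3 h4 (h6 ▸ hc) (h7 ▸ hj)) ?_ le_rfl
    rintro s₁ ⟨e1, e2, e3, e4⟩
    have g8 := e3 8 (by omega)
    have g9 := e3 9 (by omega)
    have g7 := e3 7 (by omega)
    have g6 := e3 6 (by omega)
    rw [h6, h7] at e4
    rw [h7] at g7
    rw [h6] at g6
    refine Runs.seq (t₁ := 20) (t₂ := 20) (R := fun s' => s'.rarr = R ∧ s'.nreg = s₁.nreg ∧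
      (∀ A, A ≠ 6 → A ≠ 7 → s'.narr A = s.narr A) ∧
      (∀ q, q ≠ j → s'.narr 6 q = s.narr 6 q) ∧ (∀ q, q ≠ j → s'.narr 7 q = s.narr 7 q) ∧
      ((s.narr 6 j < 1 + (frameOf R).agree n c j ∧ s'.narr 6 j = 1 + (frameOf R).agree n c j ∧
        s'.narr 7 j = c) ∨ (1 + (frameOf R).agree n c j ≤ s.narr 6 j ∧
          s'.narr 6 j = s.narr 6 j ∧ s'.narr 7 j = s.narr 7 j))) ?_ ?_ (by omega)
    · refine Runs.of_wp ?_ (by decide)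
      simp only [wp, NExpr.Ok, Test.Ok, Test.Holds, NExpr.eval, g7, g6, e4, e1, e2,
        State.updNArr_nreg, State.updNArr_rarr, true_and]
      refine ⟨fun hb => ⟨fun A hA hA' => ?_, fun q hq => ?_, fun q hq => ?_, ?_⟩, fun hb => ?_⟩
      · rw [State.updNArr_narr_of_ne _ _ _ _ hA', State.updNArr_narr_of_ne _ _ _ _ hA, e1]
      · simp [hq, e1]
      · simp [hq, e1]
      · simp [hb]
      · simp; omega
    · rintro s₂ ⟨f1, f2, f3, f4, f5, f6⟩
      refine Runs.of_wp ?_ (by decide)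
      simp only [wp, NExpr.Ok, Test.Ok, Test.Holds, NExpr.eval, f1, f2, g7, g8, g9, true_and,
        State.updNReg_nreg, State.updNReg_narr, State.updNReg_rarr, reduceIte, Nat.reduceEqDiff]
      refine ⟨fun hb' => ⟨fun x hx => ?_, f3, ?_⟩, fun hb' => ⟨fun x hx => ?_, f3, ?_⟩⟩
      · rw [if_neg (by omega), if_neg (by omega), e3 x (by omega)]
      · exact hS.step hb hc hT f4 f5 f6 _ _ (Or.inl ⟨hb', rfl, rfl⟩)
      · rw [e3 x (by omega)]
      · exact hS.step hb hc hT f4 f5 f6 _ _ (Or.inr ⟨not_lt.1 hb', rfl, rfl⟩)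
  · simp only [Test.Holds, NExpr.eval, h7, h5, Nat.lt_one_iff] at hb
    refine Runs.of_wp ?_ (by simp [maxCost])
    exact ⟨hs, fun _ _ => rfl, fun _ _ _ => rfl, hS.skip hb⟩
  · simp [Test.cost, NExpr.cost]; omega

theorem runs_findEdge {n W : ℕ} {R : ℕ → ℕ → ℝ} {a₂ a₃ a₄ : ℕ → ℕ} {s : State} {c : ℕ} {T : ℕ → ℕ}
    (hW : 4 * ((n + 1) * (n + 1)) ≤ W) (hF : (frameOf R).Upright n)
    (hP : Prepared n (frameOf R) a₂ a₃ a₄) (h0 : s.nreg 0 = n) (hs : s.rarr = R)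
    (h2 : s.narr 2 = a₂) (h3 : s.narr 3 = a₃) (h4 : s.narr 4 = a₄) (h5 : s.narr 5 = T)
    (h6 : s.nreg 6 = c) (hc : c < n) (hT : T c ≠ 0)
    (hB : ∀ q < n, T q = 0 → Best (fun x => 1 + (frameOf R).agree n x q) n T (fun x => x ≠ c)
      (s.narr 6 q) (s.narr 7 q)) :
    Runs W findEdge s ((n + 1) * ((Nat.log 2 n + 2) * 130 + 60) + 10) fun s' => s'.rarr = R ∧
      (∀ x < 7, s'.nreg x = s.nreg x) ∧ (∀ A, A ≠ 6 → A ≠ 7 → s'.narr A = s.narr A) ∧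
      Scan (fun x y => 1 + (frameOf R).agree n x y) n T c n (s'.narr 6) (s'.narr 7)
        (s'.nreg 8) (s'.nreg 9) := by
  have hnW : 4 * n + 4 ≤ W := by nlinarith
  refine Runs.seq (t₁ := 2) (t₂ := (n + 1) * ((Nat.log 2 n + 2) * 130 + 60) + 5)
    (R := fun s' => s' = s.updNReg 8 0) (Runs.of_wp ⟨Nat.zero_le _, rfl⟩ le_rfl) ?_ (by omega)
  rintro _ rfl
  refine Runs.seq (t₁ := 2) (t₂ := (n + 1) * ((Nat.log 2 n + 2) * 130 + 60))
    (R := fun s' => s' = (s.updNReg 8 0).updNReg 9 0) (Runs.of_wp ⟨Nat.zero_le _, rfl⟩ le_rfl) ?_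
    (by omega)
  rintro _ rfl
  refine Runs.forTo (N := n) (c := (Nat.log 2 n + 2) * 130 + 50) (fun j s' => s'.rarr = R ∧
      s'.nreg 7 = j ∧
      (∀ x < 7, s'.nreg x = s.nreg x) ∧ (∀ A, A ≠ 6 → A ≠ 7 → s'.narr A = s.narr A) ∧
      Scan (fun x y => 1 + (frameOf R).agree n x y) n T c j (s'.narr 6) (s'.narr 7)
        (s'.nreg 8) (s'.nreg 9)) (by omega) ?_ ?_ ?_ ?_ ?_
  · refine ⟨hs, by simp, fun x hx => ?_, fun A _ _ => rfl, ?_⟩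
    · simp only [State.updNReg_nreg]
      rw [if_neg (by omega), if_neg (by omega), if_neg (by omega)]
    · refine ⟨fun q hq hq' => ?_, fun q hq => by omega, by simp⟩
      simpa using hB q hq hq'
  · rintro j s' hj ⟨-, e2, e3, -⟩
    exact ⟨e2, trivial, by rw [NExpr.eval, e3 0 (by omega), h0]⟩
  · rintro j s' hj ⟨e1, e2, e3, e4, e5⟩ -
    refine (runs_relax hW hF hP (by rw [e3 0 (by omega), h0]) e1 (by rw [e4 2 (by omega) (by omega), h2])
      (by rw [e4 3 (by omega) (by omega), h3]) (by rw [e4 4 (by omega) (by omega), h4])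
      (by rw [e4 5 (by omega) (by omega), h5]) (by rw [e3 6 (by omega), h6]) e2 hc hj hT e5).mono
      le_rfl ?_
    rintro s'' ⟨f1, f2, f3, f4⟩
    refine ⟨by rw [f2 7 (by omega), e2], f1, by simp, fun x hx => ?_, fun A hA hA' => ?_, ?_⟩
    · rw [State.updNReg_nreg, if_neg (by omega), f2 x (by omega), e3 x hx]
    · rw [State.updNReg_narr, f3 A hA hA', e4 A hA hA']
    · simpa using f4
  · rintro s' ⟨e1, e2, e3, e4, e5⟩
    exact ⟨e1, e3, e4, e5⟩
  · simp only [NExpr.cost]; exact Nat.mul_le_mul_left _ (by omega)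

/-- The crossing distance as a weight of edges. -/
noncomputable def edgeWeight {n : ℕ} (I : Input n) : Sym2 (Fin n) → ℕ :=
  Sym2.lift ⟨fun i j => crossingDist I.lines (I.pt i) (I.pt j), fun _ _ => crossingDist_comm _ _ _⟩

/-- The invariant of Prim's algorithm after `m` rounds, on the contents of the arrays. -/
structure Grown {n : ℕ} (I : Input n) (F : Frame) (m c : ℕ) (e₀ e₁ T G P : ℕ → ℕ) : Prop where
  tree : ∃ (S : Finset (Fin n)) (E : Finset (Sym2 (Fin n))), Prim (edgeWeight I) S E ∧
    S.card = m + 1 ∧ (∀ x : Fin n, x ∈ S ↔ T x ≠ 0) ∧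
    ∀ e, e ∈ E ↔ ∃ j < m, ∃ a b : Fin n, e₀ j = a ∧ e₁ j = b ∧ e = s(a, b)
  lt : c < n
  last : T c ≠ 0
  -- The candidates do not yet take account of `c`; the next scan repairs this.
  best : ∀ q < n, T q = 0 → Best (fun x => 1 + F.agree n x q) n T (fun x => x ≠ c) (G q) (P q)

theorem Grown.exists_unreached {n : ℕ} {I : Input n} {F : Frame} {m c : ℕ}
    {e₀ e₁ T G P : ℕ → ℕ} (h : Grown I F m c e₀ e₁ T G P) (hm : m < n - 1) : ∃ q < n, T q = 0 := by
  obtain ⟨S, E, -, h2, h3, -⟩ := h.tree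
  obtain ⟨x, hx⟩ : ∃ x, x ∉ S := by
    by_contra! hc
    have : S = Finset.univ := Finset.eq_univ_iff_forall.2 hc
    rw [this, Finset.card_univ, Fintype.card_fin] at h2
    omega
  exact ⟨x, x.2, by simpa [h3] using hx⟩

/-- The scan maximises `agree` over the cut; as `agree` and crossing distance add up to `n`, the
chosen edge is a lightest one, as `Prim.insert` demands. -/
theorem Grown.succ {n : ℕ} {I : Input n} {F : Frame} (hI : F.Describes I) {m c : ℕ}
    {e₀ e₁ T G P G' P' e₀' e₁' T' : ℕ → ℕ} {best arg : ℕ} (h : Grown I F m c e₀ e₁ T G P)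
    (hm : m < n - 1) (hS : Scan (fun x y => 1 + F.agree n x y) n T c n G' P' best arg)
    (h0 : ∀ j, e₀' j = if j = m then P' arg else e₀ j)
    (h1 : ∀ j, e₁' j = if j = m then arg else e₁ j)
    (hT : ∀ j, T' j = if j = arg then 1 else T j) :
    Grown I F (m + 1) arg e₀' e₁' T' G' P' := by
  obtain ⟨f1, f2, f3, f4, f5⟩ := hS.finish (fun _ _ => by omega) h.lt h.last (h.exists_unreached hm)
  obtain ⟨S, E, g1, g2, g3, g4⟩ := h.tree
  have hv : (⟨arg, f1⟩ : Fin n) ∉ S := by rw [g3]; simpa using f2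
  have hu : (⟨P' arg, f3⟩ : Fin n) ∈ S := by rw [g3]; exact f4
  refine ⟨⟨insert ⟨arg, f1⟩ S, insert s(⟨P' arg, f3⟩, ⟨arg, f1⟩) E, g1.insert hu hv ?_, ?_, ?_, ?_⟩,
    f1, by simp [hT], ?_⟩
  · intro x hx y hy
    have e1 := hI.crossingDist_add_agree ⟨P' arg, f3⟩ ⟨arg, f1⟩
    have e2 := hI.crossingDist_add_agree x y
    have e3 := f5 x x.2 ((g3 x).1 hx) y y.2 (by simpa [g3] using hy)
    simp only at e1 e3
    simp only [edgeWeight, Sym2.lift_mk]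
    omega
  · rw [Finset.card_insert_of_notMem hv, g2]
  · intro x
    rw [Finset.mem_insert, g3, hT, Fin.ext_iff]
    by_cases hx : (x : ℕ) = arg <;> simp [hx]
  · intro e
    rw [Finset.mem_insert, g4]
    constructor
    · rintro (rfl | ⟨j, hj, a, b, ha, hb, rfl⟩)
      · exact ⟨m, by omega, _, _, by simp [h0], by simp [h1], rfl⟩
      · refine ⟨j, by omega, a, b, ?_, ?_, rfl⟩
        · rw [h0, if_neg (by omega), ha]
        · rw [h1, if_neg (by omega), hb]
    · rintro ⟨j, hj, a, b, ha, hb, rfl⟩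
      rcases eq_or_ne j m with rfl | hne
      · left
        rw [h0, if_pos rfl] at ha
        rw [h1, if_pos rfl] at hb
        rw [show a = ⟨P' arg, f3⟩ from Fin.ext ha.symm, show b = ⟨arg, f1⟩ from Fin.ext hb.symm]
      · right
        refine ⟨j, by omega, a, b, ?_, ?_, rfl⟩
        · rw [← ha, h0, if_neg hne]
        · rw [← hb, h1, if_neg hne]
  · intro q hq hq'
    rw [hT] at hq'
    have hqa : q ≠ arg := by rintro rfl; simp at hq'
    rw [if_neg hqa] at hq'
    have hb := hS.cand q hq hq'
    refine ⟨fun x hx hx' hne => hb.1 x hx ?_ (Or.inl hq), hb.2.imp_right fun ⟨a, b, c⟩ => ⟨a, ?_, c⟩⟩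
    · rwa [hT, if_neg hne] at hx'
    · rw [hT]; split_ifs
      · exact one_ne_zero
      · exact b

theorem runs_prim {n W : ℕ} {R : ℕ → ℕ → ℝ} {a₂ a₃ a₄ : ℕ → ℕ} {s : State} {I : Input n}
    (hn : 1 ≤ n) (hW : 4 * ((n + 1) * (n + 1)) ≤ W) (hF : (frameOf R).Upright n)
    (hI : (frameOf R).Describes I)
    (hP : Prepared n (frameOf R) a₂ a₃ a₄) (h0 : s.nreg 0 = n) (hs : s.rarr = R)
    (h2 : s.narr 2 = a₂) (h3 : s.narr 3 = a₃) (h4 : s.narr 4 = a₄)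
    (hz : ∀ A, 4 < A → s.narr A = fun _ => 0) :
    Runs W prim s ((n + 1) * ((n + 1) * ((Nat.log 2 n + 2) * 130 + 60) + 60)) fun s' =>
      IsMST I.lines I.pt (outputGraph n s') := by
  have hnW : 4 * n + 4 ≤ W := by nlinarith
  obtain ⟨L, hL⟩ : ∃ L, L = (n + 1) * ((Nat.log 2 n + 2) * 130 + 60) := ⟨_, rfl⟩
  rw [← hL]
  refine Runs.seq (t₁ := 10) (t₂ := n * (L + 50))
    (R := fun s' => s' = (s.updNArr 5 0 1).updNReg 6 0) (Runs.of_wp ?_ (by decide)) ?_ ?_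
  · exact ⟨Nat.zero_le _, show 1 ≤ W by omega, Nat.zero_le _, rfl⟩
  · rintro _ rfl
    refine Runs.forTo (N := n - 1) (c := L + 40)
      (fun m s' => s'.rarr = R ∧ s'.nreg 0 = n ∧ s'.nreg 5 = m ∧ s'.narr 2 = a₂ ∧ s'.narr 3 = a₃ ∧
        s'.narr 4 = a₄ ∧ Grown I (frameOf R) m (s'.nreg 6) (s'.narr 0) (s'.narr 1) (s'.narr 5)
          (s'.narr 6) (s'.narr 7)) (by omega) ?_ ?_ ?_ ?_ ?_
    · simp only [State.updNReg_nreg, State.updNReg_narr, State.updNReg_rarr, State.updNArr_nreg,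
        State.updNArr_rarr, reduceIte, Nat.reduceEqDiff]
      have hk : ∀ B, B ≠ 5 → (s.updNArr 5 0 1).narr B = s.narr B :=
        fun B hB => s.updNArr_narr_of_ne 5 0 1 hB
      rw [hk 0 (by omega), hk 1 (by omega), hk 2 (by omega), hk 3 (by omega), hk 4 (by omega),
        hk 6 (by omega), hk 7 (by omega), hz 6 (by omega), hz 7 (by omega)]
      refine ⟨hs, h0, trivial, h2, h3, h4,
        ⟨{⟨0, hn⟩}, ∅, Prim.singleton _, by simp, fun x => ?_, by simp⟩, hn, by simp, ?_⟩
      · simp [Fin.ext_iff, hz 5]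
      · intro q hq hq'
        -- Vertex `0` is the whole tree and is excluded as the last vertex, so the zero-filled
        -- arrays are valid candidates.
        refine ⟨fun x hx hx' hne => ?_, Or.inl rfl⟩
        simp [hz 5] at hx' hne
        exact absurd hx' hne
    · rintro m s' hm ⟨-, e2, e3, -⟩
      refine ⟨e3, ⟨trivial, show 1 ≤ W by omega⟩, ?_⟩
      simp only [NExpr.eval, e2]
    · rintro m s' hm ⟨e1, e2, e3, e4, e5, e6, e7⟩ -
      refine Runs.seq (t₂ := 30)
        (runs_findEdge hW hF hP e2 e1 e4 e5 e6 rfl rfl e7.lt e7.last e7.best) ?_ (by omega)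
      rintro s₁ ⟨f1, f2, f3, f4⟩
      have g5 := f2 5 (by omega)
      rw [e3] at g5
      have g0 := f2 0 (by omega)
      rw [e2] at g0
      refine Runs.of_wp ?_ (by decide)
      simp only [wp, NExpr.Ok, NExpr.eval, State.updNArr_nreg, State.updNReg_nreg, State.updNReg_narr,
        State.updNReg_rarr, State.updNArr_rarr, g5, g0, f1, true_and, reduceIte, Nat.reduceEqDiff,
        OfNat.zero_ne_ofNat]
      refine ⟨by omega, ?_, ?_, ?_, ?_⟩
      · simp only [State.updNArr_narr_of_ne, ne_eq, Nat.reduceEqDiff, not_false_eq_true]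
        rw [f3 2 (by omega) (by omega), e4]
      · simp only [State.updNArr_narr_of_ne, ne_eq, Nat.reduceEqDiff, not_false_eq_true]
        rw [f3 3 (by omega) (by omega), e5]
      · simp only [State.updNArr_narr_of_ne, ne_eq, Nat.reduceEqDiff, not_false_eq_true]
        rw [f3 4 (by omega) (by omega), e6]
      · have h6 : ∀ (s : State) (i j k u v w : ℕ) (B : ℕ), B = 6 ∨ B = 7 →
            (((s.updNArr 0 i u).updNArr 1 j v).updNArr 5 k w).narr B = s.narr B := by
          intro s i j k u v w B hB
          rw [State.updNArr_narr_of_ne _ _ _ _ (by omega),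
            State.updNArr_narr_of_ne _ _ _ _ (by omega), State.updNArr_narr_of_ne _ _ _ _ (by omega)]
        rw [h6 _ _ _ _ _ _ _ 6 (Or.inl rfl), h6 _ _ _ _ _ _ _ 7 (Or.inr rfl)]
        refine e7.succ hI hm f4 (fun j => ?_) (fun j => ?_) (fun j => ?_)
        · simp [f3]
        · simp [f3]
        · simp [f3]
    · rintro s' ⟨e1, e2, e3, e4, e5, e6, e7⟩
      obtain ⟨S, E, g1, g2, g3, g4⟩ := e7.tree
      have hS : S = Finset.univ := by
        rw [← Finset.card_eq_iff_eq_univ, g2, Fintype.card_fin]; omega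
      subst hS
      have : NeZero n := ⟨by omega⟩
      have hE : outputGraph n s' = SimpleGraph.fromEdgeSet (E : Set (Sym2 (Fin n))) := by
        unfold outputGraph
        congr 1
        ext e
        simp only [Finset.mem_coe, g4, Set.mem_ofPred_eq]
        constructor
        · rintro ⟨m, hm, h⟩
          exact ⟨m, by omega, h⟩
        · rintro ⟨m, hm, h⟩
          exact ⟨m, by omega, h⟩
      rw [hE]
      exact g1.fromEdgeSet_minimal
    · simp only [NExpr.cost]
      rw [Nat.sub_add_cancel hn]
      exact Nat.mul_le_mul_left _ (by omega)
  · have : n * (L + 50) ≤ n * (L + 60) := Nat.mul_le_mul_left _ (by omega)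
    rw [Nat.succ_mul]
    omega

/-! ### Assembly and asymptotics -/

/-- The whole program. -/
def mstProgram : Prog := .seq normalizeLines (.seq sortLines (.seq countPrefixes prim))

theorem computesMST_mstProgram :
    ComputesMST mstProgram 4 fun n => 1000 * (n + 1) ^ 2 * (Nat.log 2 n + 2) := by
  intro n hn I
  have hW : 4 * ((n + 1) * (n + 1)) ≤ (n + 1) ^ 4 := by
    -- This uses `1 ≤ n` and is why the exponent `4` suffices for table indices and intermediate
    -- sums.
    have : 4 ≤ (n + 1) * (n + 1) := by nlinarith
    calc 4 * ((n + 1) * (n + 1)) ≤ (n + 1) * (n + 1) * ((n + 1) * (n + 1)) :=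
          Nat.mul_le_mul_right _ this
      _ = (n + 1) ^ 4 := by ring
  have hnW : 4 * n + 4 ≤ (n + 1) ^ 4 := by nlinarith
  generalize (n + 1) ^ 4 = W at hW hnW
  have hr : Runs W mstProgram I.initial ((n + 1) * 80 + ((n + 1) * ((n + 1) * 50 + 20) +
      ((n + 1) * (n + 1) * 130 + (n + 1) * ((n + 1) * ((Nat.log 2 n + 2) * 130 + 60) + 60))))
      fun s' => IsMST I.lines I.pt (outputGraph n s') := by
    refine Runs.seq (runs_normalizeLines I (by omega)) (fun s₁ h₁ => ?_) le_rfl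
    refine Runs.seq (runs_sortLines (by omega) h₁.2.2.1 h₁.1 h₁.2.1 rfl) (fun s₂ h₂ => ?_) le_rfl
    refine Runs.seq (runs_countPrefixes hW h₂.1 h₂.2.1 h₂.2.2.1 h₂.2.2.2) (fun s₃ h₃ => ?_) le_rfl
    exact runs_prim hn hW h₁.2.2.1 h₁.2.2.2 h₃.2.2.2 h₃.1 h₃.2.2.1 rfl rfl rfl h₃.2.1
  obtain ⟨t, s', h1, h2, h3⟩ := hr
  refine ⟨t, s', h1, h2.trans ?_, h3⟩
  change _ ≤ 1000 * (n + 1) ^ 2 * (Nat.log 2 n + 2)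
  generalize Nat.log 2 n = k
  ring_nf
  nlinarith [Nat.zero_le (n * k), Nat.zero_le (n ^ 2 * k)]

theorem isBigO_runtime :
    (fun n : ℕ => ((1000 * (n + 1) ^ 2 * (Nat.log 2 n + 2) : ℕ) : ℝ)) =O[atTop]
      fun n : ℕ => (n : ℝ) ^ 2 * Real.log (n : ℝ) := by
  -- 12000 = 1000 · 4 · 3: for `n ≥ 2`, (n + 1)² ≤ 4n² and (`Nat.log 2 n` + 2) log 2 ≤ 3 log n.
  refine IsBigO.of_bound (12000 / Real.log 2) ?_
  filter_upwards [eventually_ge_atTop 2] with n hn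
  have hn' : (2 : ℝ) ≤ n := by exact_mod_cast hn
  have hl2 : 0 < Real.log 2 := Real.log_pos one_lt_two
  have hle : Real.log 2 ≤ Real.log n := Real.log_le_log two_pos hn'
  have h1 : (Nat.log 2 n : ℝ) * Real.log 2 ≤ Real.log n := by
    rw [← Real.log_pow]
    refine Real.log_le_log (by positivity) ?_
    exact_mod_cast Nat.pow_log_le_self 2 (by omega)
  have h2 : ((Nat.log 2 n : ℝ) + 2) * Real.log 2 ≤ 3 * Real.log n := by linarith
  have h3 : ((n : ℝ) + 1) ^ 2 ≤ 4 * (n : ℝ) ^ 2 := by nlinarith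
  rw [Real.norm_of_nonneg (by positivity),
    Real.norm_of_nonneg (mul_nonneg (by positivity) (hl2.le.trans hle)),
    div_mul_eq_mul_div, le_div_iff₀ hl2]
  push_cast
  calc 1000 * ((n : ℝ) + 1) ^ 2 * ((Nat.log 2 n : ℝ) + 2) * Real.log 2
      = 1000 * (((n : ℝ) + 1) ^ 2 * (((Nat.log 2 n : ℝ) + 2) * Real.log 2)) := by ring
    _ ≤ 1000 * ((4 * (n : ℝ) ^ 2) * (3 * Real.log n)) := by gcongr
    _ = 12000 * ((n : ℝ) ^ 2 * Real.log n) := by ring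

end CrossingMST

theorem mainTheorem8 :
    ∃ (p : RealRAM.Prog) (k : ℕ) (T : ℕ → ℕ),
      CrossingMST.ComputesMST p k T ∧
      (fun n : ℕ => (T n : ℝ)) =O[atTop] (fun n : ℕ => (n : ℝ) ^ 2 * Real.log (n : ℝ)) :=
  ⟨_, _, _, CrossingMST.computesMST_mstProgram, CrossingMST.isBigO_runtime⟩
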